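/- Fix a relational vocabulary $\tau$ containing equality and a $0$-ary relation symbol, and variables $x_0,x_1,\dots$; write $X_n=\{x_0,\dots,x_{n-1}\}$. For $m\le n$, $i_m$ is the identity map on $X_m$. Formulas are those of $\mathcal L_{\infty,\omega}(\tau)$, with conjunctions and disjunctions taken over (unordered) sets of formulas. **Formulas.** $\Psi^n_0$ is the set of conjunctions containing, for each atomic $\tau$-formula with variables in $X_n$, either it or its negation, with $x_i=x_j$ occurring positively exactly when $i=j$. $\Psi^n_{\alpha+1}$ is the set of formulas $\phi=\phi'\wedge\bigwedge_{\psi\in E}\exists x_n\psi\wedge\forall x_n(x_n\notin X_n\to\bigvee_{\psi\in E}\psi)$ with $\phi'\in\Psi^n_\alpha$ and $E\subseteq\Psi^{n+1}_\alpha$; then $E(\phi):=E$ and $V_{\alpha,\alpha+1}(\phi):=\phi'$. For limit $\alpha$, $\Psi^n_\alpha$ is the set of conjunctions $\bigwedge_{\beta<\alpha}\psi_\beta$ with $\psi_\beta\in\Psi^n_\beta$ and $\psi_\beta=V_{\beta,\beta+1}(\psi_{\beta+1})$ for all $\beta<\alpha$, and $\psi_\beta=\bigwedge_{\gamma<\beta}\psi_\gamma$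 for limit $\beta<\alpha$; for such a formula $\phi$, $V_{\beta,\alpha}(\phi):=\psi_\beta$. Put $\Psi_\alpha=\bigcup_n\Psi^n_\alpha$, $V_{\alpha,\alpha}=\mathrm{id}$, and $V_{\alpha,\beta+1}=V_{\alpha,\beta}\circ V_{\beta,\beta+1}$ for $\alpha<\beta$. For $\phi\in\Psi^n_\alpha$ and an injection $j:X_m\to X_n$ ($m\le n$), $H^n_\alpha(\phi,j)\in\Psi^m_\alpha$ is defined by recursion: $H^n_0(\phi,j)$ is the conjunction of the conjuncts of $\phi$ with variables in $\operatorname{range}(j)$, these being replaced by their $j$-preimages; $H^n_{\alpha+1}(\phi,j)$ is the $\psi\in\Psi^m_{\alpha+1}$ with $V_{\alpha,\alpha+1}(\psi)=H^n_\alpha(V_{\alpha,\alpha+1}(\phi),j)$ and $E(\psi)=\{H^{n+1}_\alpha(\chi,j\cup\{(x_m,y)\}):\chi\in E(\phi),\ y\in X_{n+1}\setminus\operatorname{range}(j)\}$; for limit $\alpha$, $H^n_\alpha(\phi,j)=\bigwedge_{\beta<\alpha}H^n_\beta(V_{\beta,\alpha}(\phi),j)$. **Scott processes.** A sequence $\langle\Phi_\alpha:\alpha<\delta\rangle$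 is a *Scott process* if, with $\Phi^n_\alpha=\Phi_\alpha\cap\Psi^n_\alpha$: (1) $\Phi_\alpha\subseteq\Psi_\alpha$ for all $\alpha<\delta$; (2) $E(\phi)\subseteq\Phi_\alpha$ for all $\alpha+1<\delta$ and $\phi\in\Phi_{\alpha+1}$; (3) $\Phi_\alpha=V_{\alpha,\beta}[\Phi_\beta]$ for all $\alpha<\beta<\delta$; (4) $H^n_\alpha(\phi,j)\in\Phi^n_\alpha$ for all $\alpha<\delta$, $n\in\omega$, $\phi\in\Phi^n_\alpha$ and injections $j:X_n\to X_n$; (5) $\Phi^m_\alpha=H^n_\alpha[\Phi^n_\alpha\times\{i_m\}]$ for all $\alpha<\delta$ and $m<n$; (6) $E(\phi)=V_{\alpha,\alpha+1}[\{\psi\in\Phi^{n+1}_{\alpha+1}:H^{n+1}_{\alpha+1}(\psi,i_n)=\phi\}]$ for all $\alpha+1<\delta$, $n\in\omega$ and $\phi\in\Phi^n_{\alpha+1}$; (7) $E(V_{\alpha+1,\beta}(\phi))\subseteq V_{\alpha,\beta}[\{\psi\in\Phi^{n+1}_\beta:H^{n+1}_\beta(\psi,i_n)=\phi\}]$ for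 all $\alpha<\beta<\delta$, $n\in\omega$ and $\phi\in\Phi^n_\beta$; (8) for all $\alpha<\delta$, $n,m\in\omega$, $\phi\in\Phi^n_\alpha$ and $\psi\in\Phi^m_\alpha$ there are $\theta\in\Phi^{n+m}_\alpha$ and an injection $j:X_m\to X_{n+m}$ with $\phi=H^{n+m}_\alpha(\theta,i_n)$ and $\psi=H^{n+m}_\alpha(\theta,j)$. **Paths and minimal sets.** Let $\delta$ be a limit ordinal and $\Phi_\alpha\subseteq\Psi_\alpha$ for $\alpha<\delta$. A *path* through $\langle\Phi_\alpha:\alpha<\delta\rangle$ is a $\rho\in\Psi_\delta$ with $V_{\alpha,\delta}(\rho)\in\Phi_\alpha$ for all $\alpha<\delta$. For $\rho\in\Psi^n_\delta$, $F(\rho)$ is the set of all $\psi$ such that for some $k\in\omega$ and some $\alpha$ with $\alpha+k\le\delta$ one has $\psi\in\Psi^{n+k}_\alpha$ and there are $\psi_0,\dots,\psi_k$ with $\psi_0=\psi$, $\psi_p\in E(\psi_{p+1})$ for $p<k$, and $\psi_k=V_{\alpha+k,\delta}(\rho)$. For a path $\rho\in\Psi^n_\delta$, the *minimal set* $\mathrm{ms}(\rho)$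 is the set of paths $\upsilon$ for which there are $m\ge n$, $p\le m$, $\alpha_0<\delta$, $\psi_0\in\Phi^m_{\alpha_0}\cap F(\rho)$ and an injection $f:X_p\to X_m$ such that for all $\alpha\in[\alpha_0,\delta)$ and all $\psi\in\Phi^m_\alpha\cap F(\rho)$ with $V_{\alpha_0,\alpha}(\psi)=\psi_0$, $H^m_\alpha(\psi,f)=V_{\alpha,\delta}(\upsilon)$. **Theorem.** Let $\delta$ be a limit ordinal of countable cofinality, let $\langle\Phi_\alpha:\alpha<\delta\rangle$ be a Scott process such that each $\Phi_\alpha$ is countable, and let $\rho$ be a path through it. Then there exists a countable $\Phi_\delta\subseteq\Psi_\delta$ such that $\rho\in\Phi_\delta$ and $\langle\Phi_\alpha:\alpha\le\delta\rangle$ is a Scott process. Furthermore, if $\Upsilon$ is a countable subset of $\Psi_\delta$ disjoint from $\mathrm{ms}(\rho)$, then $\Phi_\delta$ can be chosen to be disjoint from $\Upsilon$. -/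

import Mathlib

open Set Ordinal Cardinal

universe v u

namespace ScottProc

/-! ### Infinitary formulas over a relational vocabulary

Conjunctions and disjunctions are unordered: raw formulas, whose conjunctions and disjunctions are
indexed by (small) types, are identified when they differ only in the indexing. -/

/-- Atomic formulas in the relation symbols of `L` and equality, with variables from `V`. -/
inductive Atom (L : FirstOrder.Language.{v, u}) (V : Type) : Type u
  | rel {k : ℕ} (R : L.Relations k) (x : Fin k → V) : Atom L V
  | eq (x y : V) : Atom L V

/-- Renaming of the variables of an atomic formula. -/
def Atom.map {L : FirstOrder.Language.{v, u}} {V W : Type} (f : V → W) : Atom L V → Atom L W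
  | .rel R x => .rel R (f ∘ x)
  | .eq x y => .eq (f x) (f y)

/-- Raw infinitary formulas; the variable symbol `x_n` is the number `n`. -/
inductive PreFormula (L : FirstOrder.Language.{v, u}) : Type (u + 1)
  | atom (a : Atom L ℕ) : PreFormula L
  | neg (φ : PreFormula L) : PreFormula L
  | imp (φ ψ : PreFormula L) : PreFormula L
  | conj {ι : Type u} (φ : ι → PreFormula L) : PreFormula L
  | disj {ι : Type u} (φ : ι → PreFormula L) : PreFormula L
  | ex (n : ℕ) (φ : PreFormula L) : PreFormula L
  | all (n : ℕ) (φ : PreFormula L) : PreFormula L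

namespace PreFormula

variable {L : FirstOrder.Language.{v, u}}

/-- Two raw formulas are equivalent when they are the same formula once conjunctions and
disjunctions are regarded as taken over sets of formulas (hereditarily). -/
def Equiv : PreFormula L → PreFormula L → Prop
  | atom a, atom b => a = b
  | neg φ, neg ψ => Equiv φ ψ
  | imp φ φ', imp ψ ψ' => Equiv φ ψ ∧ Equiv φ' ψ'
  | conj φ, conj ψ => (∀ i, ∃ j, Equiv (φ i) (ψ j)) ∧ ∀ j, ∃ i, Equiv (φ i) (ψ j)
  | disj φ, disj ψ => (∀ i, ∃ j, Equiv (φ i) (ψ j)) ∧ ∀ j, ∃ i, Equiv (φ i) (ψ j)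
  | ex n φ, ex m ψ => n = m ∧ Equiv φ ψ
  | all n φ, all m ψ => n = m ∧ Equiv φ ψ
  | _, _ => False

theorem Equiv.refl (φ : PreFormula L) : Equiv φ φ := by
  induction φ with
  | atom a => simp [Equiv]
  | neg φ ih => simpa [Equiv] using ih
  | imp φ ψ ih ih' => exact ⟨ih, ih'⟩
  | conj φ ih => exact ⟨fun i => ⟨i, ih i⟩, fun i => ⟨i, ih i⟩⟩
  | disj φ ih => exact ⟨fun i => ⟨i, ih i⟩, fun i => ⟨i, ih i⟩⟩
  | ex n φ ih => exact ⟨rfl, ih⟩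
  | all n φ ih => exact ⟨rfl, ih⟩

theorem Equiv.symm {φ ψ : PreFormula L} (h : Equiv φ ψ) : Equiv ψ φ := by
  induction φ generalizing ψ with
  | atom a => cases ψ <;> simp_all [Equiv]
  | neg φ ih => cases ψ <;> simp_all [Equiv]
  | imp φ ψ ih ih' => cases ψ <;> simp_all [Equiv]
  | conj φ ih =>
    cases ψ <;> simp only [Equiv] at h
    exact ⟨fun j => (h.2 j).imp fun i hi => ih i hi, fun i => (h.1 i).imp fun j hj => ih i hj⟩
  | disj φ ih =>
    cases ψ <;> simp only [Equiv] at h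
    exact ⟨fun j => (h.2 j).imp fun i hi => ih i hi, fun i => (h.1 i).imp fun j hj => ih i hj⟩
  | ex n φ ih => cases ψ <;> simp_all [Equiv]
  | all n φ ih => cases ψ <;> simp_all [Equiv]

theorem Equiv.trans {φ ψ χ : PreFormula L} (h : Equiv φ ψ) (h' : Equiv ψ χ) : Equiv φ χ := by
  induction φ generalizing ψ χ with
  | atom a => cases ψ <;> cases χ <;> simp_all [Equiv]
  | neg φ ih =>
    cases ψ <;> simp only [Equiv] at h
    cases χ <;> simp only [Equiv] at h'
    exact ih h h'
  | imp φ φ' ih ih' =>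
    cases ψ <;> simp only [Equiv] at h
    cases χ <;> simp only [Equiv] at h'
    exact ⟨ih h.1 h'.1, ih' h.2 h'.2⟩
  | conj φ ih =>
    cases ψ <;> simp only [Equiv] at h
    cases χ <;> simp only [Equiv] at h'
    refine ⟨fun i => ?_, fun k => ?_⟩
    · obtain ⟨j, hj⟩ := h.1 i
      obtain ⟨k, hk⟩ := h'.1 j
      exact ⟨k, ih i hj hk⟩
    · obtain ⟨j, hj⟩ := h'.2 k
      obtain ⟨i, hi⟩ := h.2 j
      exact ⟨i, ih i hi hj⟩
  | disj φ ih =>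
    cases ψ <;> simp only [Equiv] at h
    cases χ <;> simp only [Equiv] at h'
    refine ⟨fun i => ?_, fun k => ?_⟩
    · obtain ⟨j, hj⟩ := h.1 i
      obtain ⟨k, hk⟩ := h'.1 j
      exact ⟨k, ih i hj hk⟩
    · obtain ⟨j, hj⟩ := h'.2 k
      obtain ⟨i, hi⟩ := h.2 j
      exact ⟨i, ih i hi hj⟩
  | ex n φ ih =>
    cases ψ <;> simp only [Equiv] at h
    cases χ <;> simp only [Equiv] at h'
    exact ⟨h.1.trans h'.1, ih h.2 h'.2⟩
  | all n φ ih =>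
    cases ψ <;> simp only [Equiv] at h
    cases χ <;> simp only [Equiv] at h'
    exact ⟨h.1.trans h'.1, ih h.2 h'.2⟩

instance setoid (L : FirstOrder.Language.{v, u}) : Setoid (PreFormula L) :=
  ⟨Equiv, Equiv.refl, Equiv.symm, Equiv.trans⟩

end PreFormula

/-- Infinitary formulas over the relational vocabulary `L` (together with equality), with unordered
conjunctions and disjunctions over sets of formulas. -/
def Formula (L : FirstOrder.Language.{v, u}) : Type (u + 1) := Quotient (PreFormula.setoid L)

namespace Formula

variable {L : FirstOrder.Language.{v, u}}

/-- The formula given by a raw formula. -/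
def mk (φ : PreFormula L) : Formula L := Quotient.mk (PreFormula.setoid L) φ

/-- A raw formula representing a formula. -/
noncomputable def repr (φ : Formula L) : PreFormula L := Quotient.out φ

theorem mk_repr (φ : Formula L) : mk φ.repr = φ := Quotient.out_eq φ

theorem mk_eq {φ ψ : PreFormula L} : mk φ = mk ψ ↔ φ.Equiv ψ :=
  ⟨fun h => Quotient.exact h, fun h => Quotient.sound h⟩

/-- An atomic formula. -/
def atom (a : Atom L ℕ) : Formula L := mk (.atom a)

/-- Negation. -/
noncomputable def neg (φ : Formula L) : Formula L := mk (.neg φ.repr)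

/-- Implication. -/
noncomputable def imp (φ ψ : Formula L) : Formula L := mk (.imp φ.repr ψ.repr)

/-- The formula `∃ x_n φ`. -/
noncomputable def ex (n : ℕ) (φ : Formula L) : Formula L := mk (.ex n φ.repr)

/-- The formula `∀ x_n φ`. -/
noncomputable def all (n : ℕ) (φ : Formula L) : Formula L := mk (.all n φ.repr)

open scoped Classical in
/-- The conjunction of a (small) set of formulas; the value at a class that is not a set is
irrelevant. -/
noncomputable def conj (S : Set (Formula L)) : Formula L :=
  if _h : Small.{u} S then mk (.conj fun i : Shrink.{u} S => ((equivShrink S).symm i).1.repr)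
  else mk (.conj fun i : PEmpty.{u + 1} => i.elim)

open scoped Classical in
/-- The disjunction of a (small) set of formulas; the value at a class that is not a set is
irrelevant. -/
noncomputable def disj (S : Set (Formula L)) : Formula L :=
  if _h : Small.{u} S then mk (.disj fun i : Shrink.{u} S => ((equivShrink S).symm i).1.repr)
  else mk (.disj fun i : PEmpty.{u + 1} => i.elim)

instance : Nonempty (Formula L) := ⟨conj ∅⟩

theorem repr_equiv {φ ψ : Formula L} : φ.repr.Equiv ψ.repr ↔ φ = ψ := by
  rw [← mk_eq, mk_repr, mk_repr]

theorem neg_inj {φ ψ : Formula L} : neg φ = neg ψ ↔ φ = ψ := by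
  simp [neg, mk_eq, PreFormula.Equiv, repr_equiv]

theorem imp_inj {φ φ' ψ ψ' : Formula L} : imp φ φ' = imp ψ ψ' ↔ φ = ψ ∧ φ' = ψ' := by
  simp [imp, mk_eq, PreFormula.Equiv, repr_equiv]

theorem ex_inj {n m : ℕ} {φ ψ : Formula L} : ex n φ = ex m ψ ↔ n = m ∧ φ = ψ := by
  simp [ex, mk_eq, PreFormula.Equiv, repr_equiv]

theorem all_inj {n m : ℕ} {φ ψ : Formula L} : all n φ = all m ψ ↔ n = m ∧ φ = ψ := by
  simp [all, mk_eq, PreFormula.Equiv, repr_equiv]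

theorem atom_inj {a b : Atom L ℕ} : atom a = atom b ↔ a = b := by
  simp [atom, mk_eq, PreFormula.Equiv]

theorem conj_ne_atom (S : Set (Formula L)) (a : Atom L ℕ) : conj S ≠ atom a := by
  unfold conj; split_ifs <;> simp [atom, mk_eq, PreFormula.Equiv]

theorem conj_ne_neg (S : Set (Formula L)) (φ : Formula L) : conj S ≠ neg φ := by
  unfold conj; split_ifs <;> simp [neg, mk_eq, PreFormula.Equiv]

theorem conj_ne_all (S : Set (Formula L)) (n : ℕ) (φ : Formula L) : conj S ≠ all n φ := by
  unfold conj; split_ifs <;> simp [all, mk_eq, PreFormula.Equiv]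

theorem all_ne_atom (n : ℕ) (φ : Formula L) (a : Atom L ℕ) : all n φ ≠ atom a := by
  simp [atom, all, mk_eq, PreFormula.Equiv]

theorem all_ne_neg (n : ℕ) (φ ψ : Formula L) : all n φ ≠ neg ψ := by
  simp [neg, all, mk_eq, PreFormula.Equiv]

theorem neg_ne_atom (φ : Formula L) (a : Atom L ℕ) : neg φ ≠ atom a := by
  simp [neg, atom, mk_eq, PreFormula.Equiv]

theorem conj_inj {S T : Set (Formula L)} [hS : Small.{u} S] [hT : Small.{u} T] :
    conj S = conj T ↔ S = T := by
  refine ⟨fun h => ?_, fun h => h ▸ rfl⟩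
  rw [conj, conj, dif_pos hS, dif_pos hT, mk_eq] at h
  simp only [PreFormula.Equiv, repr_equiv] at h
  ext χ
  constructor
  · intro hχ
    obtain ⟨j, hj⟩ := h.1 (equivShrink S ⟨χ, hχ⟩)
    rw [Equiv.symm_apply_apply] at hj
    exact (show χ = _ from hj) ▸ Subtype.coe_prop _
  · intro hχ
    obtain ⟨j, hj⟩ := h.2 (equivShrink T ⟨χ, hχ⟩)
    rw [Equiv.symm_apply_apply] at hj
    exact (show _ = χ from hj) ▸ Subtype.coe_prop _

theorem disj_inj {S T : Set (Formula L)} [hS : Small.{u} S] [hT : Small.{u} T] :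
    disj S = disj T ↔ S = T := by
  refine ⟨fun h => ?_, fun h => h ▸ rfl⟩
  rw [disj, disj, dif_pos hS, dif_pos hT, mk_eq] at h
  simp only [PreFormula.Equiv, repr_equiv] at h
  ext χ
  constructor
  · intro hχ
    obtain ⟨j, hj⟩ := h.1 (equivShrink S ⟨χ, hχ⟩)
    rw [Equiv.symm_apply_apply] at hj
    exact (show χ = _ from hj) ▸ Subtype.coe_prop _
  · intro hχ
    obtain ⟨j, hj⟩ := h.2 (equivShrink T ⟨χ, hχ⟩)
    rw [Equiv.symm_apply_apply] at hj
    exact (show _ = χ from hj) ▸ Subtype.coe_prop _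

/-- The set of conjuncts of a formula that is a conjunction. -/
def conjuncts (φ : Formula L) : Set (Formula L) :=
  {χ | ∃ S : Set (Formula L), Small.{u} S ∧ φ = conj S ∧ χ ∈ S}

theorem conjuncts_conj (S : Set (Formula L)) [hS : Small.{u} S] : (conj S).conjuncts = S := by
  ext χ
  constructor
  · rintro ⟨T, hT, e, hχ⟩
    rwa [conj_inj.1 e]
  · exact fun hχ => ⟨S, hS, rfl, hχ⟩

open scoped Classical in
/-- The complete conjunction of literals with variables among `x_0, …, x_{n-1}` in which exactly
the atomic formulas in `T` occur positively. -/
noncomputable def diagram (n : ℕ) (T : Set (Atom L (Fin n))) : Formula L :=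
  conj (range fun a : Atom L (Fin n) =>
    if a ∈ T then atom (a.map Fin.val) else neg (atom (a.map Fin.val)))

/-- The formula `x_n ∉ {x_0, …, x_{n-1}}`. -/
noncomputable def isNew (n : ℕ) : Formula L :=
  conj (range fun i : Fin n => neg (atom (.eq n i)))

/-- The formula
`φ' ∧ (⋀_{ψ ∈ E} ∃ x_n ψ) ∧ ∀ x_n (x_n ∉ {x_0, …, x_{n-1}} → ⋁_{ψ ∈ E} ψ)`. -/
noncomputable def step (n : ℕ) (φ' : Formula L) (E : Set (Formula L)) : Formula L :=
  conj {φ', conj (ex n '' E), all n (imp (isNew n) (disj E))}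

end Formula

open Formula

variable {L : FirstOrder.Language.{v, u}}

/-! ### The array of formulas and its projections -/

/-- `IsPsi α n φ` says that `φ` belongs to `Ψ^n_α`. -/
inductive IsPsi : Ordinal.{u} → ℕ → Formula L → Prop
  | zero (n : ℕ) (T : Set (Atom L (Fin n))) (hT : ∀ i j, Atom.eq i j ∈ T ↔ i = j) :
      IsPsi 0 n (diagram n T)
  | succ (α : Ordinal.{u}) (n : ℕ) (φ' : Formula L) (E : Set (Formula L))
      (hφ' : IsPsi α n φ') (hE : ∀ ψ ∈ E, IsPsi α (n + 1) ψ) :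
      IsPsi (α + 1) n (step n φ' E)
  | limit (α : Ordinal.{u}) (hα : Order.IsSuccLimit α) (n : ℕ)
      (ψ : Ordinal.{u} → Formula L) (E : Ordinal.{u} → Set (Formula L))
      (hψ : ∀ β < α, IsPsi β n (ψ β))
      (hE : ∀ β < α, ∀ χ ∈ E β, IsPsi β (n + 1) χ)
      (hsucc : ∀ β < α, ψ (β + 1) = step n (ψ β) (E β))
      (hlim : ∀ β < α, Order.IsSuccLimit β → ψ β = conj (ψ '' Iio β)) :
      IsPsi α n (conj (ψ '' Iio α))

/-- The set `Ψ^n_α`. -/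
def PsiN (L : FirstOrder.Language.{v, u}) (α : Ordinal.{u}) (n : ℕ) : Set (Formula L) :=
  {φ | IsPsi α n φ}

/-- The set `Ψ_α`. -/
def Psi (L : FirstOrder.Language.{v, u}) (α : Ordinal.{u}) : Set (Formula L) :=
  ⋃ n, PsiN L α n

theorem small_PsiN (α : Ordinal.{u}) (n : ℕ) : Small.{u} (PsiN L α n) := by
  induction α using WellFoundedLT.induction generalizing n with
  | ind α ih =>
    have := fun (β : Iio α) (k : ℕ) => ih β.1 β.2 k
    let B : Set (Formula L) := ⋃ (β : Iio α), ⋃ (k : ℕ), PsiN L β.1 k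
    have hB : ∀ β < α, ∀ k, PsiN L β k ⊆ B := fun β hβ k φ hφ =>
      mem_iUnion.2 ⟨⟨β, hβ⟩, mem_iUnion.2 ⟨k, hφ⟩⟩
    have : Small.{u} ((range fun T : Set (Atom L (Fin n)) => diagram n T) ∪
        ((range fun p : B × 𝒫 B => step n p.1.1 p.2.1) ∪ conj '' 𝒫 B) : Set (Formula L)) := by
      infer_instance
    refine @small_subset _ _ _ (fun φ hφ => ?_) this
    cases hφ with
    | zero n T hT => exact Or.inl ⟨T, rfl⟩
    | succ α n φ' E hφ' hE =>
      have hα : α < α + 1 := lt_add_one α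
      exact Or.inr (Or.inl ⟨⟨⟨φ', hB α hα n hφ'⟩, ⟨E, fun ψ hψ => hB α hα (n + 1) (hE ψ hψ)⟩⟩, rfl⟩)
    | limit α hα n ψ E hψ hE hsucc hlim =>
      refine Or.inr (Or.inr ⟨_, ?_, rfl⟩)
      rintro _ ⟨β, hβ, rfl⟩
      exact hB β hβ n (hψ β hβ)

theorem IsPsi.exists_conj {α : Ordinal.{u}} {n : ℕ} {φ : Formula L} (h : IsPsi α n φ) :
    ∃ S, φ = conj S := by
  cases h with
  | zero n T hT => exact ⟨_, rfl⟩
  | succ α n φ' E hφ' hE => exact ⟨_, rfl⟩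
  | limit α hα n ψ E hψ hE hsucc hlim => exact ⟨_, rfl⟩

theorem IsPsi.ne_all {α : Ordinal.{u}} {n m : ℕ} {φ ψ : Formula L} (h : IsPsi α n φ) :
    φ ≠ all m ψ := by
  obtain ⟨S, rfl⟩ := h.exists_conj
  exact conj_ne_all S m ψ

/-- Unique readability of the formulas in `Ψ_{α+1}`: their components are determined. -/
theorem step_inj {α β : Ordinal.{u}} {n m : ℕ} {φ ψ : Formula L} {S T : Set (Formula L)}
    (hφ : φ ∈ PsiN L α n) (hS : S ⊆ PsiN L α (n + 1)) (hψ : ψ ∈ PsiN L β m)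
    (hT : T ⊆ PsiN L β (m + 1)) (h : step n φ S = step m ψ T) : n = m ∧ φ = ψ ∧ S = T := by
  have := small_PsiN (L := L) α (n + 1)
  have := small_PsiN (L := L) β (m + 1)
  have := small_subset hS
  have := small_subset hT
  have h := conj_inj.1 h
  have hall : all n (imp (isNew n) (disj S)) = all m (imp (isNew m) (disj T)) := by
    have : all n (imp (isNew n) (disj S)) ∈
        ({ψ, conj (ex m '' T), all m (imp (isNew m) (disj T))} : Set (Formula L)) := by
      rw [← h]; simp
    rcases this with e | e | e
    · exact (IsPsi.ne_all hψ e.symm).elim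
    · exact (conj_ne_all _ _ _ e.symm).elim
    · exact e
  obtain ⟨rfl, h2⟩ := all_inj.1 hall
  obtain rfl := disj_inj.1 (imp_inj.1 h2).2
  refine ⟨rfl, ?_, rfl⟩
  have h1 : φ ∈ ({ψ, conj (ex n '' S), all n (imp (isNew n) (disj S))} : Set (Formula L)) := by
    rw [← h]; simp
  have h2 : ψ ∈ ({φ, conj (ex n '' S), all n (imp (isNew n) (disj S))} : Set (Formula L)) := by
    rw [h]; simp
  rcases h1 with e | e | e
  · exact e
  · rcases h2 with e' | e' | e'
    · exact e'.symm
    · exact e.trans e'.symm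
    · exact (IsPsi.ne_all hψ e').elim
  · exact (IsPsi.ne_all hφ e).elim

theorem not_mem_diagram {n : ℕ} {T : Set (Atom L (Fin n))} {α : Ordinal.{u}} {m : ℕ}
    {φ : Formula L} (h : IsPsi α m φ) : φ ∉ (diagram n T).conjuncts := by
  obtain ⟨S, rfl⟩ := h.exists_conj
  rw [diagram, conjuncts_conj]
  rintro ⟨a, ha⟩
  dsimp only at ha
  split_ifs at ha
  · exact conj_ne_atom _ _ ha.symm
  · exact conj_ne_neg _ _ ha.symm

open scoped Classical in
theorem diagram_arity {n m : ℕ} {T : Set (Atom L (Fin n))} {T' : Set (Atom L (Fin m))}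
    (hT' : ∀ i j, Atom.eq i j ∈ T' ↔ i = j) (h : diagram n T = diagram m T') : m ≤ n := by
  by_contra hlt
  have h := conj_inj.1 h
  have : atom (.eq n n) ∈ range fun a : Atom L (Fin n) =>
      if a ∈ T then atom (a.map Fin.val) else neg (atom (a.map Fin.val)) := by
    rw [h]
    refine ⟨.eq ⟨n, not_le.1 hlt⟩ ⟨n, not_le.1 hlt⟩, ?_⟩
    simp [hT', Atom.map]
  obtain ⟨a, ha⟩ := this
  dsimp only at ha
  split_ifs at ha
  · have := atom_inj.1 ha
    cases a with
    | rel R x => simp [Atom.map] at this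
    | eq x y => exact absurd (Atom.eq.inj this).1 x.2.ne
  · exact neg_ne_atom _ _ ha

theorem diagram_ne_step {n m : ℕ} {T : Set (Atom L (Fin n))} {φ : Formula L}
    {S : Set (Formula L)} {α : Ordinal.{u}} {k : ℕ} (hφ : IsPsi α k φ) :
    diagram n T ≠ step m φ S := by
  intro e
  refine not_mem_diagram hφ (n := n) (T := T) ?_
  rw [e, step, conjuncts_conj]
  simp

theorem diagram_ne_limit {n m : ℕ} {T : Set (Atom L (Fin n))} {α : Ordinal.{u}}
    (hα : Order.IsSuccLimit α) {ψ : Ordinal.{u} → Formula L} (hψ : ∀ β < α, IsPsi β m (ψ β)) :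
    diagram n T ≠ conj (ψ '' Iio α) := by
  intro e
  have h0 : (0 : Ordinal.{u}) < α := hα.bot_lt
  refine not_mem_diagram (hψ 0 h0) (n := n) (T := T) ?_
  rw [e, conjuncts_conj]
  exact ⟨0, h0, rfl⟩

theorem step_ne_limit {n m : ℕ} {φ : Formula L} {S : Set (Formula L)} {α : Ordinal.{u}}
    {ψ : Ordinal.{u} → Formula L} (hψ : ∀ β < α, IsPsi β m (ψ β)) :
    step n φ S ≠ conj (ψ '' Iio α) := by
  intro e
  have : all n (imp (isNew n) (disj S)) ∈ ψ '' Iio α := by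
    rw [← conj_inj.1 e]; simp
  obtain ⟨β, hβ, e⟩ := this
  exact (hψ β hβ).ne_all e

/-- The sets `Ψ^n_α` are pairwise disjoint. -/
theorem IsPsi.unique {α β : Ordinal.{u}} {n m : ℕ} {φ : Formula L} (h : IsPsi α n φ)
    (h' : IsPsi β m φ) : α = β ∧ n = m := by
  induction h generalizing β m with
  | zero n T hT =>
    generalize hχ : diagram n T = χ at h'
    cases h' with
    | zero m T' hT' =>
      exact ⟨rfl, le_antisymm (diagram_arity hT hχ.symm) (diagram_arity hT' hχ)⟩
    | succ β m φ' S hφ' hS => exact (diagram_ne_step hφ' hχ).elim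
    | limit β hβ m ψ S hψ hS hsucc hlim => exact (diagram_ne_limit hβ hψ hχ).elim
  | succ α n φ' S hφ' hS ih _ =>
    generalize hχ : step n φ' S = χ at h'
    cases h' with
    | zero m T' hT' => exact (diagram_ne_step hφ' hχ.symm).elim
    | succ β m ψ T hψ hT =>
      obtain ⟨rfl, rfl, rfl⟩ := step_inj hφ' hS hψ hT hχ
      exact ⟨by rw [(ih hψ).1], rfl⟩
    | limit β hβ m ψ S hψ hS hsucc hlim => exact (step_ne_limit hψ hχ).elim
  | limit α hα n ψ S hψ hS hsucc hlim ih _ =>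
    generalize hχ : conj (ψ '' Iio α) = χ at h'
    cases h' with
    | zero m T' hT' => exact (diagram_ne_limit hα hψ hχ.symm).elim
    | succ β m φ T hφ hT => exact (step_ne_limit hψ hχ.symm).elim
    | limit β hβ m ψ' S' hψ' hS' hsucc' hlim' =>
      have e := conj_inj.1 hχ
      have key : ∀ γ < α, γ < β ∧ n = m := fun γ hγ => by
        obtain ⟨γ', hγ', e'⟩ := e ▸ mem_image_of_mem ψ (show γ ∈ Iio α from hγ)
        have := ih γ hγ (e' ▸ hψ' γ' hγ')
        exact ⟨this.1 ▸ hγ', this.2⟩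
      refine ⟨le_antisymm (le_of_forall_lt fun γ hγ => (key γ hγ).1) (not_lt.1 fun hlt => ?_),
        (key 0 hα.bot_lt).2⟩
      obtain ⟨γ, hγ, e'⟩ := e.symm ▸ mem_image_of_mem ψ' (show α ∈ Iio β from hlt)
      exact (show γ < α from hγ).ne (ih γ hγ (e'.symm ▸ hψ' α hlt)).1

/-- The set `E(φ)`, for `φ` in some `Ψ_{α+1}`. -/
def E (φ : Formula L) : Set (Formula L) :=
  {ψ | ∃ (α : Ordinal.{u}) (n : ℕ) (φ' : Formula L) (E' : Set (Formula L)),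
    φ' ∈ PsiN L α n ∧ E' ⊆ PsiN L α (n + 1) ∧ φ = step n φ' E' ∧ ψ ∈ E'}

/-- The first conjunct `φ'` of a formula `φ` in some `Ψ_{α+1}`. -/
noncomputable def firstConjunct (φ : Formula L) : Formula L :=
  Classical.epsilon fun φ' => ∃ (α : Ordinal.{u}) (n : ℕ) (E' : Set (Formula L)),
    φ' ∈ PsiN L α n ∧ E' ⊆ PsiN L α (n + 1) ∧ φ = step n φ' E'

/-- The conjunct in `Ψ_α` of a formula `φ` in `Ψ_β`, for a limit ordinal `β > α`. -/
noncomputable def conjunctAt (α : Ordinal.{u}) (φ : Formula L) : Formula L :=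
  Classical.epsilon fun χ => χ ∈ φ.conjuncts ∧ χ ∈ Psi L α

theorem E_step {α : Ordinal.{u}} {n : ℕ} {φ' : Formula L} {E' : Set (Formula L)}
    (hφ' : φ' ∈ PsiN L α n) (hE' : E' ⊆ PsiN L α (n + 1)) : E (step n φ' E') = E' := by
  ext ψ
  constructor
  · rintro ⟨β, m, χ, T, hχ, hT, e, hψ⟩
    obtain ⟨-, -, rfl⟩ := step_inj hφ' hE' hχ hT e
    exact hψ
  · exact fun hψ => ⟨α, n, φ', E', hφ', hE', rfl, hψ⟩

theorem firstConjunct_step {α : Ordinal.{u}} {n : ℕ} {φ' : Formula L} {E' : Set (Formula L)}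
    (hφ' : φ' ∈ PsiN L α n) (hE' : E' ⊆ PsiN L α (n + 1)) :
    firstConjunct (step n φ' E') = φ' := by
  obtain ⟨β, m, T, hχ, hT, e⟩ := Classical.epsilon_spec
    (p := fun χ => ∃ (β : Ordinal.{u}) (m : ℕ) (T : Set (Formula L)),
      χ ∈ PsiN L β m ∧ T ⊆ PsiN L β (m + 1) ∧ step n φ' E' = step m χ T)
    ⟨φ', α, n, E', hφ', hE', rfl⟩
  exact (step_inj hφ' hE' hχ hT e).2.1.symm

theorem conjunctAt_limit {α β : Ordinal.{u}} (hα : α < β) {n : ℕ} {ψ : Ordinal.{u} → Formula L}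
    (hψ : ∀ γ < β, ψ γ ∈ PsiN L γ n) : conjunctAt α (conj (ψ '' Iio β)) = ψ α := by
  have h := Classical.epsilon_spec
    (p := fun χ => χ ∈ (conj (ψ '' Iio β)).conjuncts ∧ χ ∈ Psi L α)
    ⟨ψ α, by rw [conjuncts_conj]; exact ⟨α, hα, rfl⟩, mem_iUnion.2 ⟨n, hψ α hα⟩⟩
  change conjunctAt α (conj (ψ '' Iio β)) ∈ _ ∧ conjunctAt α (conj (ψ '' Iio β)) ∈ _ at h
  rw [conjuncts_conj] at h
  obtain ⟨⟨γ, hγ, e⟩, h2⟩ := h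
  obtain ⟨m, hm⟩ := mem_iUnion.1 h2
  rw [← e] at hm ⊢
  rw [(IsPsi.unique (hψ γ hγ) hm).1]

open scoped Classical in
/-- The vertical projection `V α β : Ψ_β → Ψ_α`, for `α ≤ β` (its other values are irrelevant). -/
noncomputable def V (α β : Ordinal.{u}) : Formula L → Formula L :=
  Ordinal.limitRecOn (motive := fun _ => Formula L → Formula L) β
    id
    (fun β Vβ φ => if α = β + 1 then φ else Vβ (firstConjunct φ))
    (fun β _ _ φ => if α = β then φ else conjunctAt α φ)

/-- The map `j ∪ {(x_m, y)}` from `X_{m+1}` to `X_{n+1}`, where `y ∉ range j`. -/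
def extend {m n : ℕ} (j : Fin m ↪ Fin n) (y : Fin (n + 1)) (hy : ∀ i, (j i).castSucc ≠ y) :
    Fin (m + 1) ↪ Fin (n + 1) where
  toFun := Fin.snoc (α := fun _ => Fin (n + 1)) (fun i => (j i).castSucc) y
  inj' := by
    intro a b
    induction a using Fin.lastCases with
    | last =>
      induction b using Fin.lastCases with
      | last => simp
      | cast b => simpa using fun h => (hy b h.symm).elim
    | cast a =>
      induction b using Fin.lastCases with
      | last => simpa using fun h => (hy a h).elim
      | cast b => simp

/-- The formula `H^n_0(φ, j)`: all literals in `φ` whose variables lie in the range of `j`, with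
these variables replaced by their `j`-preimages. -/
noncomputable def H₀ {m n : ℕ} (j : Fin m ↪ Fin n) (φ : Formula L) : Formula L :=
  conj {χ | ∃ a : Atom L (Fin m),
    (χ = atom (a.map Fin.val) ∧ atom ((a.map j).map Fin.val) ∈ φ.conjuncts) ∨
    (χ = neg (atom (a.map Fin.val)) ∧ neg (atom ((a.map j).map Fin.val)) ∈ φ.conjuncts)}

/-- The horizontal projection functions: `H α j φ` is `H^n_α(φ, j)`, for `φ ∈ Ψ^n_α` and an
injection `j` from `X_m` to `X_n`. -/
noncomputable def H (α : Ordinal.{u}) :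
    ∀ {m n : ℕ}, (Fin m ↪ Fin n) → Formula L → Formula L :=
  Ordinal.limitRecOn
    (motive := fun _ => ∀ {m n : ℕ}, (Fin m ↪ Fin n) → Formula L → Formula L) α
    (fun j φ => H₀ j φ)
    (fun α Hα {m _} j φ => step m (Hα j (V α (α + 1) φ))
      {χ | ∃ ψ ∈ E φ, ∃ y hy, χ = Hα (extend j y hy) ψ})
    (fun α _ Hβ _ _ j φ => conj {χ | ∃ (β : Ordinal.{u}) (hβ : β < α), χ = Hβ β hβ j (V β α φ)})

/-! ### Scott processes -/

/-- The identity map from `X_m` into `X_n`, for `m ≤ n`. -/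
abbrev incl {m n : ℕ} (h : m ≤ n) : Fin m ↪ Fin n := Fin.castLEEmb h

/-- `⟨Φ_α : α < δ⟩` is a Scott process (of length `δ`); only the values of `Φ` at ordinals below
`δ` matter. -/
structure IsScottProcess (δ : Ordinal.{u}) (Φ : Ordinal.{u} → Set (Formula L)) : Prop where
  subset_Psi : ∀ α < δ, Φ α ⊆ Psi L α
  E_subset : ∀ α, α + 1 < δ → ∀ φ ∈ Φ (α + 1), E φ ⊆ Φ α
  image_V : ∀ α β, α < β → β < δ → Φ α = V α β '' Φ β
  perm_mem : ∀ α < δ, ∀ (n : ℕ) (j : Fin n ↪ Fin n), ∀ φ ∈ Φ α ∩ PsiN L α n,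
    H α j φ ∈ Φ α ∩ PsiN L α n
  image_H : ∀ α < δ, ∀ (m n : ℕ) (h : m < n),
    Φ α ∩ PsiN L α m = H α (incl h.le) '' (Φ α ∩ PsiN L α n)
  E_eq : ∀ α, α + 1 < δ → ∀ n : ℕ, ∀ φ ∈ Φ (α + 1) ∩ PsiN L (α + 1) n,
    E φ = V α (α + 1) '' {ψ | ψ ∈ Φ (α + 1) ∩ PsiN L (α + 1) (n + 1) ∧
      H (α + 1) (incl n.le_succ) ψ = φ}
  E_V_subset : ∀ α β, α < β → β < δ → ∀ n : ℕ, ∀ φ ∈ Φ β ∩ PsiN L β n,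
    E (V (α + 1) β φ) ⊆ V α β '' {ψ | ψ ∈ Φ β ∩ PsiN L β (n + 1) ∧
      H β (incl n.le_succ) ψ = φ}
  amalgamate : ∀ α < δ, ∀ n m : ℕ, ∀ φ ∈ Φ α ∩ PsiN L α n, ∀ ψ ∈ Φ α ∩ PsiN L α m,
    ∃ θ ∈ Φ α ∩ PsiN L α (n + m), ∃ j : Fin m ↪ Fin (n + m),
      φ = H α (incl (n.le_add_right m)) θ ∧ ψ = H α j θ

/-! ### Paths and minimal sets -/

/-- `φ` is a path through `⟨Φ_α : α < β⟩`. -/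
def IsPath (β : Ordinal.{u}) (Φ : Ordinal.{u} → Set (Formula L)) (φ : Formula L) : Prop :=
  φ ∈ Psi L β ∧ ∀ α < β, V α β φ ∈ Φ α

/-- The set `F(φ)`, for `φ ∈ Ψ_β`. -/
def F (β : Ordinal.{u}) (φ : Formula L) : Set (Formula L) :=
  {ψ | ∃ (m n : ℕ) (α : Ordinal.{u}), φ ∈ PsiN L β m ∧ α + n ≤ β ∧ ψ ∈ PsiN L α (m + n) ∧
    ∃ s : ℕ → Formula L, s 0 = ψ ∧ (∀ p < n, s p ∈ E (s (p + 1))) ∧ s n = V (α + n) β φ}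

/-- The minimal set of the path `φ` according to `⟨Φ_α : α < β⟩`. -/
def ms (β : Ordinal.{u}) (Φ : Ordinal.{u} → Set (Formula L)) (φ : Formula L) : Set (Formula L) :=
  {υ | IsPath β Φ υ ∧ ∃ n : ℕ, φ ∈ PsiN L β n ∧
    ∃ m ≥ n, ∃ p ≤ m, ∃ α₀ < β, ∃ ψ₀ ∈ Φ α₀ ∩ PsiN L α₀ m ∩ F β φ, ∃ f : Fin p ↪ Fin m,
      ∀ α, α₀ ≤ α → α < β → ∀ ψ ∈ Φ α ∩ PsiN L α m ∩ F β φ, V α₀ α ψ = ψ₀ →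
        H α f ψ = V α β υ}

end ScottProc

namespace ScottProc

open Formula

variable {L : FirstOrder.Language.{v, u}}

/-! ### Vertical projections -/

/-! A path is the complete description, below level `δ`, of a finite tuple. The new level is built
as all descriptions of finite subtuples of a single countable generic tuple that begins with a tuple
described by `ρ`; the construction is a forcing argument with countably many dense sets.

A condition is a path extending `ρ` together with a level below `δ`. Only the projection of the path
to that level is a commitment: a stronger condition may use a different path above it. Extensions
exist because conditions (6) and (7) let an element of `E(V_{α+1,δ}(σ))` be lifted from level to
level; along a cofinal ω-sequence the lifts converge to a path with one more variable
(`exists_path_of_mem_E`). Iterating, an extension of a projection of `σ` by `m` variables comes from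
a path extending `σ`, at the price of `m` levels of agreement (`exists_path_of_H_eq`). As `δ` is a
limit, finitely many levels can always be spared. In the same way, below `δ` the set `F(ρ)` consists
exactly of the projections of paths extending `ρ`.

The dense requirements are: arity and level grow; every formula of the process is realized (by
amalgamation); every element of a relevant `E` is realized; and every path in `Υ` is omitted by
every subtuple. The last one is dense because a condition with no extension omitting `υ` is itself a
witness that `υ ∈ ms(ρ)` (`exists_ge_avoiding`). Countability of the `Φ_α`, of `Υ` and of the
cofinality leaves countably many requirements, so one increasing sequence of conditions meets them
all.

Its limits `G N` describe the initial segments of one infinite tuple. Their horizontal projections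
form the new level. Closure, arity and amalgamation, i.e. (4), (5) and (8), hold because all the
formulas come from the same tuple; (3) and (7) are the realization requirements; (2) and (6) say
nothing new at a limit level. -/

theorem V_self (α : Ordinal.{u}) (φ : Formula L) : V α α φ = φ := by
  induction α using Ordinal.limitRecOn with
  | zero => simp [V]
  | add_one α ih => simp [V]
  | limit α hα ih => simp [V, Ordinal.limitRecOn_limit _ _ _ _ hα]

theorem V_add_one {α β : Ordinal.{u}} (h : α ≤ β) (φ : Formula L) :
    V α (β + 1) φ = V α β (firstConjunct φ) := by
  have : α ≠ β + 1 := (Order.lt_add_one_iff.2 h).ne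
  simp [V, this]

theorem V_limit {α β : Ordinal.{u}} (h : α < β) (hβ : Order.IsSuccLimit β) (φ : Formula L) :
    V α β φ = conjunctAt α φ := by
  simp [V, Ordinal.limitRecOn_limit _ _ _ _ hβ, h.ne]

theorem IsPsi.exists_step {α : Ordinal.{u}} {n : ℕ} {φ : Formula L} (h : IsPsi (α + 1) n φ) :
    ∃ φ' ∈ PsiN L α n, ∃ T ⊆ PsiN L α (n + 1), φ = step n φ' T := by
  generalize hβ : α + 1 = β at h
  cases h with
  | zero n T hT => simp at hβ
  | succ γ n φ' T hφ' hT =>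
    obtain rfl : α = γ := Order.add_one_inj.1 hβ
    exact ⟨φ', hφ', T, hT, rfl⟩
  | limit _ hα n ψ T hψ hE hsucc hlim => subst hβ; simp at hα

theorem V_add_one_step {α β : Ordinal.{u}} (h : α ≤ β) {n : ℕ} {φ : Formula L}
    {T : Set (Formula L)} (hφ : φ ∈ PsiN L β n) (hT : T ⊆ PsiN L β (n + 1)) :
    V α (β + 1) (step n φ T) = V α β φ := by
  rw [V_add_one h, firstConjunct_step hφ hT]

theorem IsPsi.E_subset {α : Ordinal.{u}} {n : ℕ} {φ : Formula L} (h : IsPsi (α + 1) n φ) :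
    E φ ⊆ PsiN L α (n + 1) := by
  obtain ⟨φ', hφ', T, hT, rfl⟩ := h.exists_step
  rwa [E_step hφ' hT]

theorem IsPsi.eq_step {α : Ordinal.{u}} {n : ℕ} {φ : Formula L} (h : IsPsi (α + 1) n φ) :
    φ = step n (V α (α + 1) φ) (E φ) := by
  obtain ⟨φ', hφ', T, hT, rfl⟩ := h.exists_step
  rw [E_step hφ' hT, V_add_one_step le_rfl hφ' hT, V_self]

theorem IsPsi.V_add_one_mem {α : Ordinal.{u}} {n : ℕ} {φ : Formula L} (h : IsPsi (α + 1) n φ) :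
    IsPsi α n (V α (α + 1) φ) := by
  obtain ⟨φ', hφ', T, hT, rfl⟩ := h.exists_step
  rwa [V_add_one_step le_rfl hφ' hT, V_self]

/-- `ψ` is a coherent sequence of formulas `ψ β ∈ Ψ^n_β`, for `β < α`. -/
structure IsThread (α : Ordinal.{u}) (n : ℕ) (ψ : Ordinal.{u} → Formula L) : Prop where
  mem : ∀ β < α, IsPsi β n (ψ β)
  succ : ∀ β, β + 1 < α → V β (β + 1) (ψ (β + 1)) = ψ β
  limit : ∀ β < α, Order.IsSuccLimit β → ψ β = conj (ψ '' Iio β)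

theorem V_conj {α β : Ordinal.{u}} (h : α < β) (hβ : Order.IsSuccLimit β) {n : ℕ}
    {ψ : Ordinal.{u} → Formula L} (hψ : ∀ γ < β, IsPsi γ n (ψ γ)) :
    V α β (conj (ψ '' Iio β)) = ψ α := by
  rw [V_limit h hβ, conjunctAt_limit h hψ]

theorem IsPsi.exists_thread {α : Ordinal.{u}} (hα : Order.IsSuccLimit α) {n : ℕ} {φ : Formula L}
    (h : IsPsi α n φ) : ∃ ψ, IsThread α n ψ ∧ φ = conj (ψ '' Iio α) := by
  cases h with
  | zero n T hT => exact (hα.ne_bot rfl).elim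
  | succ β n φ' T hφ' hT => simp at hα
  | limit _ _ n ψ T hψ hE hsucc hlim =>
    refine ⟨ψ, ⟨hψ, fun β hβ => ?_, hlim⟩, rfl⟩
    have hβ' : β < α := (lt_add_one β).trans hβ
    rw [hsucc β hβ', V_add_one_step le_rfl (hψ β hβ') (hE β hβ'), V_self]

theorem IsThread.V_eq {α : Ordinal.{u}} {n : ℕ} {ψ : Ordinal.{u} → Formula L}
    (h : IsThread α n ψ) {β γ : Ordinal.{u}} (hβ : β ≤ γ) (hγ : γ < α) : V β γ (ψ γ) = ψ β := by
  induction γ using Ordinal.limitRecOn with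
  | zero => obtain rfl : β = 0 := le_bot_iff.1 hβ
            exact V_self _ _
  | add_one γ ih =>
    obtain rfl | hβ := hβ.eq_or_lt
    · exact V_self _ _
    have hβ := Order.lt_add_one_iff.1 hβ
    have hm := h.mem _ hγ
    rw [hm.eq_step, V_add_one_step hβ hm.V_add_one_mem hm.E_subset, h.succ γ hγ,
      ih hβ ((lt_add_one γ).trans hγ)]
  | limit γ hlim ih =>
    obtain rfl | hβ := hβ.eq_or_lt
    · exact V_self _ _
    rw [h.limit γ hγ hlim, V_conj hβ hlim fun δ hδ => h.mem δ (hδ.trans hγ)]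

/-- The sets of extensions demanded by the limit clause of `IsPsi` need no extra data: they are read
off from the next term of the thread, `E (ψ (β + 1))`. -/
theorem IsThread.isPsi_conj {α : Ordinal.{u}} {n : ℕ} {ψ : Ordinal.{u} → Formula L}
    (hα : Order.IsSuccLimit α) (h : IsThread α n ψ) : IsPsi α n (conj (ψ '' Iio α)) :=
  have hs : ∀ β < α, IsPsi (β + 1) n (ψ (β + 1)) := fun β hβ => h.mem _ (hα.add_one_lt hβ)
  .limit α hα n ψ (fun β => E (ψ (β + 1))) h.mem (fun β hβ => (hs β hβ).E_subset)
    (fun β hβ => by rw [← h.succ β (hα.add_one_lt hβ)]; exact (hs β hβ).eq_step) h.limit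

theorem IsPsi.V_mem {α β : Ordinal.{u}} (hαβ : α ≤ β) {n : ℕ} {φ : Formula L}
    (h : IsPsi β n φ) : IsPsi α n (V α β φ) := by
  induction β using Ordinal.limitRecOn generalizing φ with
  | zero => obtain rfl : α = 0 := le_bot_iff.1 hαβ
            rwa [V_self]
  | add_one β ih =>
    obtain rfl | hαβ := hαβ.eq_or_lt
    · rwa [V_self]
    have hαβ := Order.lt_add_one_iff.1 hαβ
    rw [h.eq_step, V_add_one_step hαβ h.V_add_one_mem h.E_subset]
    exact ih hαβ h.V_add_one_mem
  | limit β hβ ih =>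
    obtain rfl | hαβ := hαβ.eq_or_lt
    · rwa [V_self]
    obtain ⟨ψ, hψ, rfl⟩ := h.exists_thread hβ
    rw [V_conj hαβ hβ hψ.mem]
    exact hψ.mem α hαβ

theorem IsPsi.V_V {α β γ : Ordinal.{u}} (hαβ : α ≤ β) (hβγ : β ≤ γ) {n : ℕ} {φ : Formula L}
    (h : IsPsi γ n φ) : V α β (V β γ φ) = V α γ φ := by
  induction γ using Ordinal.limitRecOn generalizing φ with
  | zero => obtain rfl : β = 0 := le_bot_iff.1 hβγ
            rw [V_self]
  | add_one γ ih =>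
    obtain rfl | hβγ := hβγ.eq_or_lt
    · rw [V_self]
    have hβγ := Order.lt_add_one_iff.1 hβγ
    rw [h.eq_step, V_add_one_step hβγ h.V_add_one_mem h.E_subset,
      V_add_one_step (hαβ.trans hβγ) h.V_add_one_mem h.E_subset]
    exact ih hβγ h.V_add_one_mem
  | limit γ hγ ih =>
    obtain rfl | hβγ := hβγ.eq_or_lt
    · rw [V_self]
    obtain ⟨ψ, hψ, rfl⟩ := h.exists_thread hγ
    rw [V_conj hβγ hγ hψ.mem, V_conj (hαβ.trans_lt hβγ) hγ hψ.mem, hψ.V_eq hαβ hβγ]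

theorem IsPsi.eq_conj {α : Ordinal.{u}} (hα : Order.IsSuccLimit α) {n : ℕ} {φ : Formula L}
    (h : IsPsi α n φ) : φ = conj ((fun β => V β α φ) '' Iio α) := by
  obtain ⟨ψ, hψ, rfl⟩ := h.exists_thread hα
  congr 1
  exact image_congr fun β hβ => (V_conj hβ hα hψ.mem).symm

/-- A formula of limit level is the conjunction of its own vertical projections. This reduces
identities at limit levels to identities below. -/
theorem IsPsi.ext_limit {α : Ordinal.{u}} (hα : Order.IsSuccLimit α) {n m : ℕ} {φ ψ : Formula L}
    (hφ : IsPsi α n φ) (hψ : IsPsi α m ψ) (h : ∀ β < α, V β α φ = V β α ψ) : φ = ψ := by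
  rw [hφ.eq_conj hα, hψ.eq_conj hα]
  congr 1
  exact image_congr fun β hβ => h β hβ

/-- Compatibility with all vertical projections already forces the conjunction clause at limits, by
`IsPsi.eq_conj`. -/
theorem IsThread.of_V {α : Ordinal.{u}} {n : ℕ} {ψ : Ordinal.{u} → Formula L}
    (hψ : ∀ β < α, IsPsi β n (ψ β)) (hV : ∀ β γ, β ≤ γ → γ < α → V β γ (ψ γ) = ψ β) :
    IsThread α n ψ where
  mem := hψ
  succ β hβ := hV β (β + 1) (lt_add_one β).le hβ
  limit β hβ hlim := by
    rw [(hψ β hβ).eq_conj hlim]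
    congr 1
    exact image_congr fun γ hγ => hV γ β (le_of_lt hγ) hβ

/-- A coherent sequence has a limit in `Ψ_α`. -/
theorem exists_limit {α : Ordinal.{u}} (hα : Order.IsSuccLimit α) {n : ℕ}
    {ψ : Ordinal.{u} → Formula L} (hψ : ∀ β < α, IsPsi β n (ψ β))
    (hV : ∀ β γ, β ≤ γ → γ < α → V β γ (ψ γ) = ψ β) :
    ∃ φ, IsPsi α n φ ∧ ∀ β < α, V β α φ = ψ β :=
  ⟨_, (IsThread.of_V hψ hV).isPsi_conj hα, fun _ hβ => V_conj hβ hα hψ⟩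

/-! ### Horizontal projections -/

theorem H_zero {m n : ℕ} (j : Fin m ↪ Fin n) (φ : Formula L) : H 0 j φ = H₀ j φ := by
  simp [H]

theorem H_add_one (α : Ordinal.{u}) {m n : ℕ} (j : Fin m ↪ Fin n) (φ : Formula L) :
    H (α + 1) j φ = step m (H α j (V α (α + 1) φ))
      {χ | ∃ ψ ∈ E φ, ∃ y hy, χ = H α (extend j y hy) ψ} := by
  simp [H]

theorem H_limit {α : Ordinal.{u}} (hα : Order.IsSuccLimit α) {m n : ℕ} (j : Fin m ↪ Fin n)
    (φ : Formula L) : H α j φ = conj ((fun β => H β j (V β α φ)) '' Iio α) := by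
  simp only [H, Ordinal.limitRecOn_limit _ _ _ _ hα]
  congr 1
  ext χ
  simp [eq_comm]

/-! ### Renaming in atoms and in diagrams of level 0 -/

theorem Atom.map_map {A B C : Type} (f : A → B) (g : B → C) (a : Atom L A) :
    (a.map f).map g = a.map (g ∘ f) := by
  cases a <;> rfl

theorem Atom.map_injective {A B : Type} {f : A → B} (hf : Function.Injective f) :
    Function.Injective (Atom.map (L := L) f) := by
  intro a b h
  cases a <;> cases b <;> simp only [Atom.map, Atom.rel.injEq, Atom.eq.injEq, reduceCtorEq] at h ⊢
  · obtain ⟨rfl, h1, h2⟩ := h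
    refine ⟨rfl, h1, heq_of_eq (funext fun i => hf (congr_fun (eq_of_heq h2) i))⟩
  · exact ⟨hf h.1, hf h.2⟩

theorem Atom.map_val_inj {n : ℕ} {a b : Atom L (Fin n)} :
    a.map Fin.val = b.map Fin.val ↔ a = b :=
  (Atom.map_injective Fin.val_injective).eq_iff

theorem atom_mem_diagram {n : ℕ} {T : Set (Atom L (Fin n))} {a : Atom L (Fin n)} :
    atom (a.map Fin.val) ∈ (diagram n T).conjuncts ↔ a ∈ T := by
  rw [diagram, conjuncts_conj]
  constructor
  · rintro ⟨b, hb⟩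
    dsimp only at hb
    split_ifs at hb with h
    · rwa [Atom.map_val_inj.1 (atom_inj.1 hb)] at h
    · exact (neg_ne_atom _ _ hb).elim
  · exact fun h => ⟨a, if_pos h⟩

theorem neg_atom_mem_diagram {n : ℕ} {T : Set (Atom L (Fin n))} {a : Atom L (Fin n)} :
    neg (atom (a.map Fin.val)) ∈ (diagram n T).conjuncts ↔ a ∉ T := by
  rw [diagram, conjuncts_conj]
  constructor
  · rintro ⟨b, hb⟩
    dsimp only at hb
    split_ifs at hb with h
    · exact (neg_ne_atom _ _ hb.symm).elim
    · rwa [Atom.map_val_inj.1 (atom_inj.1 (neg_inj.1 hb))] at h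
  · exact fun h => ⟨a, if_neg h⟩

theorem H₀_diagram {m n : ℕ} (j : Fin m ↪ Fin n) (T : Set (Atom L (Fin n))) :
    H₀ j (diagram n T) = diagram m (Atom.map j ⁻¹' T) := by
  simp only [H₀, atom_mem_diagram, neg_atom_mem_diagram]
  rw [diagram]
  congr 1
  ext χ
  refine exists_congr fun a => ?_
  by_cases h : a.map j ∈ T <;> simp [h, eq_comm]

theorem IsPsi.exists_diagram {n : ℕ} {φ : Formula L} (h : IsPsi 0 n φ) :
    ∃ T : Set (Atom L (Fin n)), (∀ i j, Atom.eq i j ∈ T ↔ i = j) ∧ φ = diagram n T := by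
  generalize hβ : (0 : Ordinal.{u}) = β at h
  cases h with
  | zero n T hT => exact ⟨T, hT, rfl⟩
  | succ γ n φ' T hφ' hT => exact ((lt_add_one γ).ne_bot hβ.symm).elim
  | limit _ hα n ψ T hψ hE hsucc hlim => exact (hα.ne_bot hβ.symm).elim

theorem IsPsi.H_zero_mem {m n : ℕ} (j : Fin m ↪ Fin n) {φ : Formula L} (h : IsPsi 0 n φ) :
    IsPsi 0 m (H 0 j φ) := by
  obtain ⟨T, hT, rfl⟩ := h.exists_diagram
  rw [H_zero, H₀_diagram]
  -- Injectivity of `j` keeps `x_i = x_k` positive exactly when `i = k`.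
  exact .zero m _ fun i k => by simp [Atom.map, hT]

theorem IsPsi.H_add_one_mem {α : Ordinal.{u}}
    (ih : ∀ {m n : ℕ} (j : Fin m ↪ Fin n) {φ : Formula L}, IsPsi α n φ → IsPsi α m (H α j φ))
    {m n : ℕ} (j : Fin m ↪ Fin n) {φ : Formula L} (h : IsPsi (α + 1) n φ) :
    IsPsi (α + 1) m (H (α + 1) j φ) := by
  rw [H_add_one]
  refine .succ α m _ _ (ih j h.V_add_one_mem) ?_
  rintro _ ⟨ψ, hψ, y, hy, rfl⟩
  exact ih _ (h.E_subset hψ)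

/-- The horizontal projections map `Ψ^n_β` to `Ψ^m_β` and commute with the vertical ones. -/
theorem IsPsi.H_mem_and_V_H {β : Ordinal.{u}} {m n : ℕ} (j : Fin m ↪ Fin n) {φ : Formula L}
    (h : IsPsi β n φ) :
    IsPsi β m (H β j φ) ∧ ∀ α ≤ β, V α β (H β j φ) = H α j (V α β φ) := by
  -- Membership and commutation are proved together: at a limit, the projections form a thread
  -- precisely because they commute with `V` below. The arities vary since a successor step passes
  -- to `m + 1` and `n + 1`.
  induction β using Ordinal.limitRecOn generalizing m n φ with
  | zero =>
    refine ⟨h.H_zero_mem j, fun α hα => ?_⟩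
    obtain rfl : α = 0 := le_bot_iff.1 hα
    rw [V_self, V_self]
  | add_one β ih =>
    refine ⟨h.H_add_one_mem (fun j _ h => (ih j h).1) j, fun α hα => ?_⟩
    obtain rfl | hα := hα.eq_or_lt
    · rw [V_self, V_self]
    have hα := Order.lt_add_one_iff.1 hα
    rw [H_add_one, V_add_one_step hα, (ih j h.V_add_one_mem).2 α hα, h.V_V hα (lt_add_one β).le]
    · exact (ih j h.V_add_one_mem).1
    · rintro _ ⟨ψ, hψ, y, hy, rfl⟩
      exact (ih _ (h.E_subset hψ)).1
  | limit β hβ ih =>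
    have hmem : ∀ γ < β, IsPsi γ m (H γ j (V γ β φ)) := fun γ hγ => (ih γ hγ j (h.V_mem hγ.le)).1
    have hV : ∀ α γ, α ≤ γ → γ < β → V α γ (H γ j (V γ β φ)) = H α j (V α β φ) :=
      fun α γ hα hγ => by rw [(ih γ hγ j (h.V_mem hγ.le)).2 α hα, h.V_V hα hγ.le]
    rw [H_limit hβ]
    refine ⟨(IsThread.of_V hmem hV).isPsi_conj hβ, fun α hα => ?_⟩
    obtain rfl | hα := hα.eq_or_lt
    · rw [V_self, V_self, H_limit hβ]
    · exact V_conj hα hβ hmem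

theorem IsPsi.H_mem {α : Ordinal.{u}} {m n : ℕ} (j : Fin m ↪ Fin n) {φ : Formula L}
    (h : IsPsi α n φ) : IsPsi α m (H α j φ) :=
  (h.H_mem_and_V_H j).1

theorem IsPsi.V_H {α β : Ordinal.{u}} (hαβ : α ≤ β) {m n : ℕ} (j : Fin m ↪ Fin n)
    {φ : Formula L} (h : IsPsi β n φ) : V α β (H β j φ) = H α j (V α β φ) :=
  (h.H_mem_and_V_H j).2 α hαβ

theorem IsPsi.E_H {α : Ordinal.{u}} {m n : ℕ} (j : Fin m ↪ Fin n) {φ : Formula L}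
    (h : IsPsi (α + 1) n φ) :
    E (H (α + 1) j φ) = {χ | ∃ ψ ∈ E φ, ∃ y hy, χ = H α (extend j y hy) ψ} := by
  rw [H_add_one, E_step (h.V_add_one_mem.H_mem j)]
  rintro _ ⟨ψ, hψ, y, hy, rfl⟩
  exact (show IsPsi _ _ _ from h.E_subset hψ).H_mem _

/-! ### Functoriality of the horizontal projections -/

@[simp]
theorem extend_castSucc {m n : ℕ} (j : Fin m ↪ Fin n) (y : Fin (n + 1)) (hy) (i : Fin m) :
    extend j y hy i.castSucc = (j i).castSucc := by
  change Fin.snoc (α := fun _ => Fin (n + 1)) (fun i => (j i).castSucc) y i.castSucc = _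
  simp

@[simp]
theorem extend_last {m n : ℕ} (j : Fin m ↪ Fin n) (y : Fin (n + 1)) (hy) :
    extend j y hy (Fin.last m) = y := by
  change Fin.snoc (α := fun _ => Fin (n + 1)) (fun i => (j i).castSucc) y (Fin.last m) = _
  simp

theorem ext_of_castSucc {m n : ℕ} {f g : Fin (m + 1) ↪ Fin n}
    (h : ∀ i : Fin m, f i.castSucc = g i.castSucc) (h' : f (Fin.last m) = g (Fin.last m)) :
    f = g := by
  ext i
  induction i using Fin.lastCases with
  | last => rw [h']
  | cast i => rw [h]

theorem IsPsi.H_H {α : Ordinal.{u}} {l m n : ℕ} (k : Fin l ↪ Fin m) (j : Fin m ↪ Fin n)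
    {φ : Formula L} (h : IsPsi α n φ) : H α k (H α j φ) = H α (k.trans j) φ := by
  induction α using Ordinal.limitRecOn generalizing l m n φ with
  | zero =>
    obtain ⟨T, hT, rfl⟩ := h.exists_diagram
    simp only [H_zero, H₀_diagram]
    congr 1
    ext a
    simp only [mem_preimage, Atom.map_map]
    rfl
  | add_one α ih =>
    rw [H_add_one α k, h.V_H (lt_add_one α).le, ih k j h.V_add_one_mem, h.E_H, H_add_one]
    congr 1
    ext χ
    constructor
    · rintro ⟨_, ⟨ψ, hψ, y, hy, rfl⟩, z, hz, rfl⟩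
      refine ⟨ψ, hψ, extend j y hy z, fun i hi => ?_, ?_⟩
      · rw [Function.Embedding.trans_apply, ← extend_castSucc j y hy (k i)] at hi
        exact hz i ((extend j y hy).injective hi)
      · rw [ih _ _ (h.E_subset hψ)]
        congr 1
        exact ext_of_castSucc (fun i => by simp) (by simp)
    · rintro ⟨ψ, hψ, w, hw, rfl⟩
      -- The new point `w` avoids the range of `k.trans j` but may lie in that of `j`. If `w = j z`,
      -- then `j` is extended by a fresh last variable and `k` by `z`; otherwise `j` is extended by
      -- `w` and `k` by the last variable.
      by_cases hr : ∃ z, (j z).castSucc = w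
      · obtain ⟨z, rfl⟩ := hr
        have hz : ∀ i, (k i).castSucc ≠ z.castSucc := fun i e =>
          hw i (by rw [Function.Embedding.trans_apply, Fin.castSucc_injective _ e])
        refine ⟨_, ⟨ψ, hψ, Fin.last n, fun i => (Fin.castSucc_lt_last _).ne, rfl⟩,
          z.castSucc, hz, ?_⟩
        rw [ih _ _ (h.E_subset hψ)]
        congr 1
        exact ext_of_castSucc (fun i => by simp) (by simp)
      · push Not at hr
        refine ⟨_, ⟨ψ, hψ, w, hr, rfl⟩, Fin.last m, fun i => (Fin.castSucc_lt_last _).ne, ?_⟩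
        rw [ih _ _ (h.E_subset hψ)]
        congr 1
        exact ext_of_castSucc (fun i => by simp) (by simp)
  | limit α hα ih =>
    refine ((h.H_mem j).H_mem k).ext_limit hα (h.H_mem _) fun β hβ => ?_
    rw [(h.H_mem j).V_H hβ.le, h.V_H hβ.le, h.V_H hβ.le, ih β hβ k j (h.V_mem hβ.le)]

theorem IsPsi.H_refl {α : Ordinal.{u}} {n : ℕ} {φ : Formula L} (h : IsPsi α n φ)
    (j : Fin n ↪ Fin n) (hj : ∀ i, j i = i) : H α j φ = φ := by
  induction α using Ordinal.limitRecOn generalizing n φ with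
  | zero =>
    obtain ⟨T, hT, rfl⟩ := h.exists_diagram
    rw [H_zero, H₀_diagram]
    congr 1
    ext a
    have hj' : ⇑j = id := funext hj
    cases a <;> simp [hj', Atom.map]
  | add_one α ih =>
    rw [H_add_one, ih h.V_add_one_mem j hj]
    conv_rhs => rw [h.eq_step]
    congr 1
    have key : ∀ (y : Fin (n + 1)) (hy : ∀ i, (j i).castSucc ≠ y), ∀ i, extend j y hy i = i := by
      intro y hy i
      induction i using Fin.lastCases with
      | last =>
        rw [extend_last]
        -- As `j` is onto, the only value left for the added variable is the last one.
        induction y using Fin.lastCases with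
        | last => rfl
        | cast y => exact (hy y (by rw [hj])).elim
      | cast i => rw [extend_castSucc, hj]
    ext χ
    constructor
    · rintro ⟨ψ, hψ, y, hy, rfl⟩
      rwa [ih (h.E_subset hψ) _ (key y hy)]
    · intro hχ
      have hy : ∀ i, (j i).castSucc ≠ Fin.last n := fun i => (Fin.castSucc_lt_last _).ne
      exact ⟨χ, hχ, Fin.last n, hy, (ih (h.E_subset hχ) _ (key _ hy)).symm⟩
  | limit α hα ih =>
    refine (h.H_mem j).ext_limit hα h fun β hβ => ?_
    rw [h.V_H hβ.le, ih β hβ (h.V_mem hβ.le) j hj]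

/-! ### Paths through a Scott process -/

/-- Finite suprema of an enumerated cofinal subset stay below `δ` and increase. -/
theorem exists_monotone_cofinal {δ : Ordinal.{u}} (hcof : δ.cof = ℵ₀) :
    ∃ a : ℕ → Ordinal.{u}, Monotone a ∧ (∀ k, a k < δ) ∧ ∀ β < δ, ∃ k, β ≤ a k := by
  obtain ⟨s, hs, hs'⟩ := Order.exists_cof_eq (Iio δ)
  rw [Ordinal.cof_Iio, ← Ordinal.lift_cof, hcof, Cardinal.lift_aleph0] at hs'
  have : Countable s := Cardinal.mk_le_aleph0_iff.1 hs'.le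
  have : Nonempty s := Cardinal.mk_ne_zero_iff.1 (by rw [hs']; exact Cardinal.aleph0_ne_zero)
  obtain ⟨b, hb⟩ := exists_surjective_nat s
  refine ⟨fun k => (partialSups (fun i => (b i).1) k).1, fun i k h => ?_, fun k => ?_,
    fun β hβ => ?_⟩
  · exact (partialSups (fun i => (b i).1)).monotone h
  · exact (partialSups (fun i => (b i).1) k).2
  · obtain ⟨x, hx, hle⟩ := hs ⟨β, hβ⟩
    obtain ⟨k, hk⟩ := hb ⟨x, hx⟩
    refine ⟨k, le_trans (show β ≤ x.1 from hle) ?_⟩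
    have := le_partialSups (fun i => (b i).1) k
    beta_reduce at this
    rw [hk] at this
    exact this

theorem add_one_add_natCast (α : Ordinal.{u}) (k : ℕ) : α + 1 + k = α + (k + 1 : ℕ) := by
  rw [add_assoc, Nat.add_comm k 1, Nat.cast_add, Nat.cast_one]

/-- A coherent sequence along a cofinal ω-sequence determines the whole thread: the term at `β` is
projected from any later `f k`, and `key` shows that the choice of `k` is immaterial. -/
theorem exists_limit_seq {δ : Ordinal.{u}} (hδ : Order.IsSuccLimit δ) {a : ℕ → Ordinal.{u}}
    (ha : Monotone a) (haδ : ∀ k, a k < δ) (hcof : ∀ β < δ, ∃ k, β ≤ a k) {n : ℕ}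
    {f : ℕ → Formula L} (hf : ∀ k, IsPsi (a k) n (f k))
    (hV : ∀ i k, i ≤ k → V (a i) (a k) (f k) = f i) :
    ∃ φ, IsPsi δ n φ ∧ ∀ k, V (a k) δ φ = f k := by
  choose! κ hκ using hcof
  have key : ∀ β k, β < δ → β ≤ a k → V β (a (κ β)) (f (κ β)) = V β (a k) (f k) := by
    intro β k hβ hk
    obtain h | h := le_total k (κ β)
    · rw [← hV k _ h, (hf _).V_V hk (ha h)]
    · rw [← hV _ k h, (hf _).V_V (hκ β hβ) (ha h)]
  obtain ⟨φ, hφ, hφV⟩ := exists_limit hδ (n := n) (ψ := fun β => V β (a (κ β)) (f (κ β)))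
    (fun β hβ => (hf _).V_mem (hκ β hβ)) (fun β γ hβγ hγ => by
      rw [(hf _).V_V hβγ (hκ γ hγ), key β (κ γ) (hβγ.trans_lt hγ) (hβγ.trans (hκ γ hγ))])
  refine ⟨φ, hφ, fun k => ?_⟩
  rw [hφV _ (haδ k), key _ k (haδ k) le_rfl, V_self]

theorem IsPsi.ext_cofinal {δ : Ordinal.{u}} (hδ : Order.IsSuccLimit δ) {n m : ℕ}
    {φ ψ : Formula L} (hφ : IsPsi δ n φ) (hψ : IsPsi δ m ψ)
    (h : ∀ β < δ, ∃ γ, β ≤ γ ∧ γ < δ ∧ V γ δ φ = V γ δ ψ) : φ = ψ := by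
  refine hφ.ext_limit hδ hψ fun β hβ => ?_
  obtain ⟨γ, hβγ, hγ, e⟩ := h β hβ
  rw [← hφ.V_V hβγ hγ.le, ← hψ.V_V hβγ hγ.le, e]

/-- `σ` is a path of arity `n`. -/
structure IsPathN (δ : Ordinal.{u}) (Φ : Ordinal.{u} → Set (Formula L)) (n : ℕ)
    (σ : Formula L) : Prop where
  isPsi : IsPsi δ n σ
  mem : ∀ α < δ, V α δ σ ∈ Φ α

theorem IsPathN.isPath {δ : Ordinal.{u}} {Φ : Ordinal.{u} → Set (Formula L)} {n : ℕ}
    {σ : Formula L} (h : IsPathN δ Φ n σ) : IsPath δ Φ σ :=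
  ⟨mem_iUnion.2 ⟨n, h.isPsi⟩, h.mem⟩

theorem IsPath.exists_isPathN {δ : Ordinal.{u}} {Φ : Ordinal.{u} → Set (Formula L)}
    {σ : Formula L} (h : IsPath δ Φ σ) : ∃ n, IsPathN δ Φ n σ := by
  obtain ⟨n, hn⟩ := mem_iUnion.1 h.1
  exact ⟨n, hn, h.2⟩

theorem IsPathN.mem_inter {δ : Ordinal.{u}} {Φ : Ordinal.{u} → Set (Formula L)} {n : ℕ}
    {σ : Formula L} (h : IsPathN δ Φ n σ) {α : Ordinal.{u}} (hα : α < δ) :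
    V α δ σ ∈ Φ α ∩ PsiN L α n :=
  ⟨h.mem α hα, h.isPsi.V_mem hα.le⟩

theorem incl_trans_incl {l m n : ℕ} (h : l ≤ m) (h' : m ≤ n) :
    (incl h).trans (incl h') = incl (h.trans h') := rfl

/-- Factors an arbitrary injection into an inclusion and a permutation, the two kinds of map treated
by conditions (5) and (4). -/
theorem exists_perm_extending {m n : ℕ} (h : m ≤ n) (j : Fin m ↪ Fin n) :
    ∃ e : Fin n ↪ Fin n, (incl h).trans e = j := by
  classical
  let e : {x // x ∈ range (incl h)} ≃ {x // x ∈ range j} :=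
    (Equiv.ofInjective _ (incl h).injective).symm.trans (Equiv.ofInjective _ j.injective)
  refine ⟨e.extendSubtype.toEmbedding, ?_⟩
  ext i
  rw [Function.Embedding.trans_apply, Equiv.coe_toEmbedding,
    Equiv.extendSubtype_apply_of_mem _ _ (mem_range_self i)]
  simp only [e, Equiv.trans_apply]
  rw [Equiv.ofInjective_symm_apply (incl h).injective i]
  rfl

/-! ### Closure under projections, and extension of paths -/

namespace IsScottProcess

variable {δ : Ordinal.{u}} {Φ : Ordinal.{u} → Set (Formula L)}

theorem V_mem (hΦ : IsScottProcess δ Φ) {α β : Ordinal.{u}} (hαβ : α ≤ β) (hβ : β < δ)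
    {φ : Formula L} (h : φ ∈ Φ β) : V α β φ ∈ Φ α := by
  obtain rfl | hαβ := hαβ.eq_or_lt
  · rwa [V_self]
  · rw [hΦ.image_V α β hαβ hβ]
    exact mem_image_of_mem _ h

theorem V_mem_inter (hΦ : IsScottProcess δ Φ) {α β : Ordinal.{u}} (hαβ : α ≤ β) (hβ : β < δ)
    {n : ℕ} {φ : Formula L} (h : φ ∈ Φ β ∩ PsiN L β n) : V α β φ ∈ Φ α ∩ PsiN L α n :=
  ⟨hΦ.V_mem hαβ hβ h.1, IsPsi.V_mem hαβ h.2⟩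

theorem exists_V_eq (hΦ : IsScottProcess δ Φ) {α β : Ordinal.{u}} (hαβ : α ≤ β) (hβ : β < δ)
    {n : ℕ} {φ : Formula L} (h : φ ∈ Φ α ∩ PsiN L α n) :
    ∃ ψ ∈ Φ β ∩ PsiN L β n, V α β ψ = φ := by
  obtain rfl | hαβ := hαβ.eq_or_lt
  · exact ⟨φ, h, V_self _ _⟩
  · have h1 := h.1
    rw [hΦ.image_V α β hαβ hβ] at h1
    obtain ⟨ψ, hψ, rfl⟩ := h1
    obtain ⟨m, hm⟩ := mem_iUnion.1 (hΦ.subset_Psi β hβ hψ)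
    obtain ⟨-, rfl⟩ := IsPsi.unique (IsPsi.V_mem hαβ.le hm) h.2
    exact ⟨ψ, ⟨hψ, hm⟩, rfl⟩

theorem H_mem (hΦ : IsScottProcess δ Φ) {α : Ordinal.{u}} (hα : α < δ) {m n : ℕ}
    (j : Fin m ↪ Fin n) {φ : Formula L} (h : φ ∈ Φ α ∩ PsiN L α n) :
    H α j φ ∈ Φ α ∩ PsiN L α m := by
  have hmn : m ≤ n := by simpa using Fintype.card_le_of_embedding j
  obtain rfl | hlt := hmn.eq_or_lt
  · exact hΦ.perm_mem α hα _ j φ h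
  · obtain ⟨e, rfl⟩ := exists_perm_extending hmn j
    rw [← IsPsi.H_H (incl hmn) e h.2, hΦ.image_H α hα m n hlt]
    exact mem_image_of_mem _ (hΦ.perm_mem α hα n e φ h)

theorem mem_E_iff (hΦ : IsScottProcess δ Φ) {α : Ordinal.{u}} (hα : α + 1 < δ) {n : ℕ}
    {φ χ : Formula L} (hφ : φ ∈ Φ (α + 1) ∩ PsiN L (α + 1) n) :
    χ ∈ E φ ↔ ∃ ψ ∈ Φ (α + 1) ∩ PsiN L (α + 1) (n + 1), H (α + 1) (incl n.le_succ) ψ = φ ∧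
      V α (α + 1) ψ = χ := by
  rw [hΦ.E_eq α hα n φ hφ]
  simp only [mem_image, mem_ofPred_eq, and_assoc]

theorem H_of_mem_E (hΦ : IsScottProcess δ Φ) {α : Ordinal.{u}} (hα : α + 1 < δ) {n : ℕ}
    {φ χ : Formula L} (hφ : φ ∈ Φ (α + 1) ∩ PsiN L (α + 1) n) (hχ : χ ∈ E φ) :
    H α (incl n.le_succ) χ = V α (α + 1) φ := by
  obtain ⟨ψ, hψ, rfl, rfl⟩ := (hΦ.mem_E_iff hα hφ).1 hχ
  rw [IsPsi.V_H (lt_add_one α).le _ hψ.2]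

theorem isPathN_H (hΦ : IsScottProcess δ Φ) {m n : ℕ} (j : Fin m ↪ Fin n) {σ : Formula L}
    (h : IsPathN δ Φ n σ) : IsPathN δ Φ m (H δ j σ) := by
  refine ⟨h.isPsi.H_mem j, fun α hα => ?_⟩
  rw [h.isPsi.V_H hα.le]
  exact (hΦ.H_mem hα j (h.mem_inter hα)).1

theorem V_H_mem_E (hδ : Order.IsSuccLimit δ) (hΦ : IsScottProcess δ Φ) {α : Ordinal.{u}}
    (hα : α < δ) {m n : ℕ} (h : m + 1 ≤ n) {σ : Formula L} (hσ : IsPathN δ Φ n σ) :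
    V α δ (H δ (incl h) σ) ∈ E (V (α + 1) δ (H δ (incl (m.le_succ.trans h)) σ)) := by
  have hα' := hδ.add_one_lt hα
  have h1 := hΦ.isPathN_H (incl h) hσ
  rw [hΦ.mem_E_iff hα' ((hΦ.isPathN_H _ hσ).mem_inter hα')]
  refine ⟨_, h1.mem_inter hα', ?_, h1.isPsi.V_V (lt_add_one α).le hα'.le⟩
  rw [← h1.isPsi.V_H hα'.le, hσ.isPsi.H_H, incl_trans_incl]

/-- Condition (7) lifts `χ` to level `β + 1` over the projection of `σ`, and condition (6) puts the
projection of this lift to `β` into the required `E`. -/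
theorem exists_mem_E_lift (hδ : Order.IsSuccLimit δ) (hΦ : IsScottProcess δ Φ)
    {α β : Ordinal.{u}} (hαβ : α ≤ β) (hβ : β < δ) {n : ℕ} {σ χ : Formula L}
    (hσ : IsPathN δ Φ n σ) (hχ : χ ∈ E (V (α + 1) δ σ)) :
    ∃ χ' ∈ E (V (β + 1) δ σ), V α β χ' = χ := by
  have hβ' := hδ.add_one_lt hβ
  have hαβ' := Order.lt_add_one_iff.2 hαβ
  rw [← hσ.isPsi.V_V (Order.add_one_le_iff.2 hαβ') hβ'.le] at hχ
  obtain ⟨ψ, ⟨hψ, hψ'⟩, rfl⟩ := hΦ.E_V_subset α (β + 1) hαβ' hβ' n _ (hσ.mem_inter hβ') hχ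
  exact ⟨V β (β + 1) ψ, (hΦ.mem_E_iff hβ' (hσ.mem_inter hβ')).2 ⟨ψ, hψ, hψ', rfl⟩,
    IsPsi.V_V hαβ (lt_add_one β).le hψ.2⟩

/-- Every element of `E(V_{α+1,δ}(σ))` is the projection of a path one variable longer
than `σ`. -/
theorem exists_path_of_mem_E (hδ : Order.IsSuccLimit δ) (hcof : δ.cof = ℵ₀)
    (hΦ : IsScottProcess δ Φ) {α : Ordinal.{u}} (hα : α < δ) {n : ℕ} {σ χ : Formula L}
    (hσ : IsPathN δ Φ n σ) (hχ : χ ∈ E (V (α + 1) δ σ)) :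
    ∃ τ, IsPathN δ Φ (n + 1) τ ∧ H δ (incl n.le_succ) τ = σ ∧ V α δ τ = χ := by
  obtain ⟨b, hb, hbδ, hbcof⟩ := exists_monotone_cofinal hcof
  -- The cofinal sequence is made to start at `α` itself, so that the lifts start from `χ` and the
  -- limit path projects to it.
  let a : ℕ → Ordinal.{u} := fun k => k.casesOn α fun k => max α (b k)
  have ha : Monotone a := by
    refine monotone_nat_of_le_succ fun k => ?_
    cases k with
    | zero => exact le_max_left _ _
    | succ k => exact max_le_max le_rfl (hb k.le_succ)
  have haδ : ∀ k, a k < δ := fun k => by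
    cases k with
    | zero => exact hα
    | succ k => exact max_lt hα (hbδ k)
  have hacof : ∀ β < δ, ∃ k, β ≤ a k := fun β hβ =>
    (hbcof β hβ).elim fun k hk => ⟨k + 1, hk.trans (le_max_right _ _)⟩
  have step : ∀ (k : ℕ) (x : {χ // χ ∈ E (V (a k + 1) δ σ)}),
      ∃ y : {χ // χ ∈ E (V (a (k + 1) + 1) δ σ)}, V (a k) (a (k + 1)) y.1 = x.1 := fun k x => by
    obtain ⟨χ', h, h'⟩ := hΦ.exists_mem_E_lift hδ (ha k.le_succ) (haδ (k + 1)) hσ x.2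
    exact ⟨⟨χ', h⟩, h'⟩
  choose g hg using step
  let f : ∀ k : ℕ, {χ // χ ∈ E (V (a k + 1) δ σ)} := fun k => Nat.rec ⟨χ, hχ⟩ g k
  have haδ' : ∀ k, a k + 1 < δ := fun k => hδ.add_one_lt (haδ k)
  have hσk := fun k => hσ.mem_inter (haδ' k)
  have hf : ∀ k, IsPsi (a k) (n + 1) (f k).1 := fun k => (hσk k).2.E_subset (f k).2
  have hV : ∀ i k, i ≤ k → V (a i) (a k) (f k).1 = (f i).1 := by
    intro i k hik
    induction k, hik using Nat.le_induction with
    | base => exact V_self _ _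
    | succ k hik ih =>
      rw [← ih, ← hg k (f k)]
      exact ((hf (k + 1)).V_V (ha hik) (ha k.le_succ)).symm
  obtain ⟨τ, hτ, hτV⟩ := exists_limit_seq hδ ha haδ hacof hf hV
  refine ⟨τ, ⟨hτ, fun β hβ => ?_⟩, ?_, hτV 0⟩
  · obtain ⟨k, hk⟩ := hacof β hβ
    rw [← hτ.V_V hk (haδ k).le, hτV]
    exact hΦ.V_mem hk (haδ k) (hΦ.E_subset _ (haδ' k) _ (hσk k).1 (f k).2)
  · refine (hτ.H_mem _).ext_cofinal hδ hσ.isPsi fun β hβ => ?_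
    obtain ⟨k, hk⟩ := hacof β hβ
    refine ⟨a k, hk, haδ k, ?_⟩
    rw [hτ.V_H (haδ k).le, hτV, hΦ.H_of_mem_E (haδ' k) (hσk k) (f k).2,
      hσ.isPsi.V_V (lt_add_one _).le (haδ' k).le]

/-- Variables are added one at a time, each costing one level: agreement with `θ` at `α + 1` on the
earlier variables puts the projection of `θ` to `α` into the relevant `E`, whence a path agreeing
with `θ` at `α`. -/
theorem exists_path_of_H_eq (hδ : Order.IsSuccLimit δ) (hcof : δ.cof = ℵ₀)
    (hΦ : IsScottProcess δ Φ) {n : ℕ} {σ : Formula L} (hσ : IsPathN δ Φ n σ) {γ : Ordinal.{u}}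
    (hγ : γ < δ) (m : ℕ) {α : Ordinal.{u}} (hα : α + m ≤ γ) {θ : Formula L}
    (hθ : θ ∈ Φ γ ∩ PsiN L γ (n + m)) (hθσ : H γ (incl (n.le_add_right m)) θ = V γ δ σ) :
    ∃ τ, IsPathN δ Φ (n + m) τ ∧ H δ (incl (n.le_add_right m)) τ = σ ∧ V α δ τ = V α γ θ := by
  induction m generalizing α θ with
  | zero =>
    have hθ' : θ = V γ δ σ := by rw [← hθσ, IsPsi.H_refl hθ.2 _ fun i => rfl]
    refine ⟨σ, hσ, hσ.isPsi.H_refl _ fun i => rfl, ?_⟩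
    rw [hθ', hσ.isPsi.V_V (by simpa using hα) hγ.le]
  | succ m ih =>
    have hα1 : α + 1 + m ≤ γ := by rwa [add_one_add_natCast]
    have hαγ : α + 1 ≤ γ := (le_add_of_nonneg_right (zero_le)).trans hα1
    have hα' : α + 1 < δ := hαγ.trans_lt hγ
    have hm : n + m ≤ n + (m + 1) := Nat.le_succ _
    -- The induction hypothesis is applied to `θ` without its last variable, one level higher.
    obtain ⟨τ', hτ', hτσ, hτV⟩ := ih hα1 (hΦ.H_mem hγ (incl hm) hθ)
      (by rw [IsPsi.H_H _ _ hθ.2, incl_trans_incl, hθσ])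
    have hχ : V α γ θ ∈ E (V (α + 1) δ τ') := by
      rw [hΦ.mem_E_iff hα' (hτ'.mem_inter hα')]
      refine ⟨V (α + 1) γ θ, hΦ.V_mem_inter hαγ hγ hθ, ?_, IsPsi.V_V (lt_add_one α).le hαγ hθ.2⟩
      rw [hτV, IsPsi.V_H hαγ _ hθ.2]
    obtain ⟨τ, hτ, hττ, hV⟩ := hΦ.exists_path_of_mem_E hδ hcof
      ((lt_add_one α).trans hα') hτ' hχ
    refine ⟨τ, hτ, ?_, hV⟩
    rw [← hτσ, ← hττ, hτ.isPsi.H_H, incl_trans_incl]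

/-- The paths extending `ρ` project into `F(ρ)`. -/
theorem V_mem_F (hδ : Order.IsSuccLimit δ) (hΦ : IsScottProcess δ Φ) {n k : ℕ} {ρ τ : Formula L}
    (hτ : IsPathN δ Φ (n + k) τ) (hρ : H δ (incl (n.le_add_right k)) τ = ρ) {α : Ordinal.{u}}
    (hα : α < δ) : V α δ τ ∈ F δ ρ := by
  have hk : ∀ p : ℕ, α + p < δ := fun p => by
    induction p with
    | zero => simpa using hα
    | succ p ih => rw [Nat.cast_succ, ← add_assoc]; exact hδ.add_one_lt ih
  -- The arity `m'` is kept separate from `m + 1` so that the truncated subtractions below can be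
  -- matched by an equation.
  have aux : ∀ (β : Ordinal.{u}) (m m' : ℕ) (hm : m ≤ n + k) (hm' : m' ≤ n + k), β < δ →
      m' = m + 1 → V β δ (H δ (incl hm') τ) ∈ E (V (β + 1) δ (H δ (incl hm) τ)) := by
    rintro β m _ hm hm' hβ rfl
    exact hΦ.V_H_mem_E hδ hβ hm' hτ
  -- The chain witnessing membership in `F(ρ)` drops one variable of `τ` for each level gained.
  refine ⟨n, k, α, ?_, (hk k).le, hτ.isPsi.V_mem hα.le,
    fun p => V (α + p) δ (H δ (incl (show n + (k - p) ≤ n + k by omega)) τ), ?_, ?_, ?_⟩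
  · rw [← hρ]
    exact hτ.isPsi.H_mem _
  · simp only [Nat.cast_zero, add_zero]
    rw [hτ.isPsi.V_H hα.le]
    exact (hτ.isPsi.V_mem hα.le).H_refl _ fun i => rfl
  · intro p hp
    have := aux (α + p) (n + (k - (p + 1))) (n + (k - p)) (by omega) (by omega) (hk p) (by omega)
    rwa [add_assoc, ← Nat.cast_succ] at this
  · rw [← hρ]
    have aux2 : ∀ (m : ℕ) (hm : n + m ≤ n + k), m = 0 →
        H δ (incl hm) τ = H δ (incl (n.le_add_right k)) τ := by
      rintro _ hm rfl
      rfl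
    simp only [aux2 (k - k) _ (Nat.sub_self k)]

/-- The chain is climbed from its end at `ρ`: the tail starting at `s 1` yields a path agreeing with
it at level `α + 1`, and `s 0` is then realized over that path. -/
theorem exists_path_of_chain (hδ : Order.IsSuccLimit δ) (hcof : δ.cof = ℵ₀)
    (hΦ : IsScottProcess δ Φ) {n : ℕ} {ρ : Formula L} (hρ : IsPathN δ Φ n ρ) (k : ℕ)
    {α : Ordinal.{u}} (hα : α < δ) {s : ℕ → Formula L} (hs : ∀ p < k, s p ∈ E (s (p + 1)))
    (hk : s k = V (α + k) δ ρ) :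
    ∃ τ, IsPathN δ Φ (n + k) τ ∧ H δ (incl (n.le_add_right k)) τ = ρ ∧ V α δ τ = s 0 := by
  induction k generalizing α s with
  | zero => exact ⟨ρ, hρ, hρ.isPsi.H_refl _ fun i => rfl, by simpa using hk.symm⟩
  | succ k ih =>
    obtain ⟨τ', hτ', hτρ, hτV⟩ := ih (hδ.add_one_lt hα) (s := fun p => s (p + 1))
      (fun p hp => hs (p + 1) (by omega))
      (by rw [hk, add_one_add_natCast])
    obtain ⟨τ, hτ, hττ, hV⟩ := hΦ.exists_path_of_mem_E hδ hcof hα hτ'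
      (χ := s 0) (by rw [hτV]; exact hs 0 (by omega))
    refine ⟨τ, hτ, ?_, hV⟩
    rw [← hτρ, ← hττ, hτ.isPsi.H_H, incl_trans_incl]

/-- Every element of `F(ρ)` is the projection of a path extending `ρ`. -/
theorem exists_path_of_mem_F (hδ : Order.IsSuccLimit δ) (hcof : δ.cof = ℵ₀)
    (hΦ : IsScottProcess δ Φ) {n m : ℕ} {ρ ψ : Formula L} (hρ : IsPathN δ Φ n ρ)
    {α : Ordinal.{u}} (hα : α < δ) (hψ : IsPsi α m ψ) (hF : ψ ∈ F δ ρ) :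
    ∃ (h : n ≤ m) (τ : Formula L), IsPathN δ Φ m τ ∧ H δ (incl h) τ = ρ ∧ V α δ τ = ψ := by
  obtain ⟨n', k, α', hρ', -, hψ', s, rfl, hs, hk⟩ := hF
  obtain ⟨-, rfl⟩ := IsPsi.unique hρ.isPsi hρ'
  obtain ⟨rfl, rfl⟩ := IsPsi.unique hψ hψ'
  exact ⟨n.le_add_right k, hΦ.exists_path_of_chain hδ hcof hρ k hα hs hk⟩

end IsScottProcess

/-! ### Generic sequences of paths -/

/-- The Rasiowa–Sikorski lemma, in its increasing form. -/
theorem exists_monotone_meeting {P : Type*} [Preorder P] (p : P) {𝒟 : Set (Set P)}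
    (h𝒟 : 𝒟.Countable) (hD : ∀ D ∈ 𝒟, IsCofinal D) :
    ∃ c : ℕ → P, Monotone c ∧ ∀ D ∈ 𝒟, ∃ i, c i ∈ D := by
  have := h𝒟.to_subtype
  have := Encodable.ofCountable 𝒟
  let C : 𝒟 → Order.Cofinal P := fun D => ⟨D.1, hD D.1 D.2⟩
  exact ⟨_, Order.sequenceOfCofinals.monotone p C, fun D h =>
    ⟨_, Order.sequenceOfCofinals.encode_mem p C ⟨D, h⟩⟩⟩

/-- A condition is a path extending `ρ`, approximated at a level below `δ`. -/
structure Condition (δ : Ordinal.{u}) (Φ : Ordinal.{u} → Set (Formula L)) (n : ℕ)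
    (ρ : Formula L) where
  /-- The number of free variables of the path. -/
  arity : ℕ
  /-- The level at which the path is approximated. -/
  level : Ordinal.{u}
  /-- The path. -/
  path : Formula L
  le_arity : n ≤ arity
  level_lt : level < δ
  isPathN : IsPathN δ Φ arity path
  H_path : H δ (incl le_arity) path = ρ

namespace Condition

variable {δ : Ordinal.{u}} {Φ : Ordinal.{u} → Set (Formula L)} {n : ℕ} {ρ : Formula L}

theorem level_le (c : Condition δ Φ n ρ) : c.level ≤ δ := c.level_lt.le

/-- A condition is stronger than another when its approximation extends that of the other. -/
instance : Preorder (Condition δ Φ n ρ) where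
  le c d := c.level ≤ d.level ∧
    ∃ h : c.arity ≤ d.arity, V c.level δ (H δ (incl h) d.path) = V c.level δ c.path
  le_refl c := ⟨le_rfl, le_rfl, by rw [c.isPathN.isPsi.H_refl _ fun i => rfl]⟩
  le_trans c d e := by
    rintro ⟨h1, h2, h3⟩ ⟨h4, h5, h6⟩
    refine ⟨h1.trans h4, h2.trans h5, ?_⟩
    have he := e.isPathN.isPsi
    have hd := d.isPathN.isPsi
    rw [← h3, hd.V_H c.level_le, ← hd.V_V h1 d.level_le, ← h6, (he.H_mem _).V_V h1 d.level_le,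
      ← (he.H_mem _).V_H c.level_le, he.H_H, incl_trans_incl]

theorem level_mono {c d : Condition δ Φ n ρ} (h : c ≤ d) : c.level ≤ d.level := h.1

theorem arity_mono {c d : Condition δ Φ n ρ} (h : c ≤ d) : c.arity ≤ d.arity := h.2.1

/-- What a condition says about its own variables up to its level is frozen in every stronger
condition. -/
theorem V_H_of_le {c d : Condition δ Φ n ρ} (h : c ≤ d) {α : Ordinal.{u}} (hα : α ≤ c.level)
    {m : ℕ} (j : Fin m ↪ Fin c.arity) :
    V α δ (H δ (j.trans (incl (arity_mono h))) d.path) = V α δ (H δ j c.path) := by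
  have hc := c.isPathN.isPsi
  have hd := d.isPathN.isPsi
  obtain ⟨h1, h2, h3⟩ := h
  rw [← hd.H_H, (hd.H_mem _).V_H (hα.trans c.level_le), hc.V_H (hα.trans c.level_le),
    ← hc.V_V hα c.level_le, ← (hd.H_mem _).V_V hα c.level_le, h3]

/-- Extension of a condition by a path with additional variables. -/
noncomputable def extendPath (c : Condition δ Φ n ρ) {m : ℕ} (h : c.arity ≤ m) {τ : Formula L}
    (hτ : IsPathN δ Φ m τ) (e : H δ (incl h) τ = c.path) {α : Ordinal.{u}} (hα : α < δ) :
    Condition δ Φ n ρ where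
  arity := m
  level := max c.level α
  path := τ
  le_arity := c.le_arity.trans h
  level_lt := max_lt c.level_lt hα
  isPathN := hτ
  H_path := by
    have := hτ.isPsi.H_H (incl c.le_arity) (incl h)
    rwa [e, c.H_path, incl_trans_incl, eq_comm] at this

/-- Since `τ` restricts to the path of `c` itself and not merely to its approximation, the level can
be raised freely. -/
theorem le_extendPath (c : Condition δ Φ n ρ) {m : ℕ} (h : c.arity ≤ m) {τ : Formula L}
    (hτ : IsPathN δ Φ m τ) (e : H δ (incl h) τ = c.path) {α : Ordinal.{u}} (hα : α < δ) :
    c ≤ c.extendPath h hτ e hα :=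
  ⟨le_max_left _ _, h, by rw [← e]; rfl⟩

/-! ### Density of the generic requirements -/

theorem exists_ge (hδ : Order.IsSuccLimit δ) (hcof : δ.cof = ℵ₀) (hΦ : IsScottProcess δ Φ)
    (c : Condition δ Φ n ρ) (N : ℕ) {α : Ordinal.{u}} (hα : α < δ) :
    ∃ d, c ≤ d ∧ N ≤ d.arity ∧ α ≤ d.level := by
  have hN : α + N < δ := by
    clear * - hα hδ
    induction N with
    | zero => simpa using hα
    | succ p ih => rw [Nat.cast_succ, ← add_assoc]; exact hδ.add_one_lt ih
  -- Condition (5) supplies `N` more variables at level `α + N`, high enough to pay for `N`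
  -- one-variable extensions. It requires strictly larger arity, hence the separate case `N = 0`.
  obtain ⟨θ, hθ, hθσ⟩ : ∃ θ ∈ Φ (α + N) ∩ PsiN L (α + N) (c.arity + N),
      H (α + N) (incl (c.arity.le_add_right N)) θ = V (α + N) δ c.path := by
    have hσ := c.isPathN.mem_inter hN
    obtain rfl | hpos := N.eq_zero_or_pos
    · exact ⟨_, hσ, IsPsi.H_refl hσ.2 _ fun i => rfl⟩
    · rwa [hΦ.image_H _ hN c.arity (c.arity + N) (by omega)] at hσ
  obtain ⟨τ, hτ, e, -⟩ := hΦ.exists_path_of_H_eq hδ hcof c.isPathN hN N le_rfl hθ hθσ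
  exact ⟨_, c.le_extendPath _ hτ e hα, Nat.le_add_left _ _, le_max_right _ _⟩

/-- `φ` is lifted by `m` levels and amalgamated there with the path of `c`; turning the amalgam into
a path loses those `m` levels again. -/
theorem exists_ge_realizing (hδ : Order.IsSuccLimit δ) (hcof : δ.cof = ℵ₀)
    (hΦ : IsScottProcess δ Φ) (c : Condition δ Φ n ρ) {α : Ordinal.{u}} (hα : α < δ)
    {m : ℕ} {φ : Formula L} (hφ : φ ∈ Φ α ∩ PsiN L α m) :
    ∃ d, c ≤ d ∧ α ≤ d.level ∧ ∃ j : Fin m ↪ Fin d.arity, V α δ (H δ j d.path) = φ := by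
  have hm : α + m < δ := by
    clear * - hα hδ
    induction m with
    | zero => simpa using hα
    | succ p ih => rw [Nat.cast_succ, ← add_assoc]; exact hδ.add_one_lt ih
  have hαm : α ≤ α + m := le_add_of_nonneg_right zero_le
  obtain ⟨φ', hφ', rfl⟩ := hΦ.exists_V_eq hαm hm hφ
  obtain ⟨θ, hθ, j, hj, rfl⟩ :=
    hΦ.amalgamate _ hm c.arity m _ (c.isPathN.mem_inter hm) φ' hφ'
  obtain ⟨τ, hτ, e, hV⟩ := hΦ.exists_path_of_H_eq hδ hcof c.isPathN hm m le_rfl hθ hj.symm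
  refine ⟨_, c.le_extendPath _ hτ e hα, le_max_right _ _, j, ?_⟩
  change V α δ (H δ j τ) = _
  rw [hτ.isPsi.V_H hα.le, hV, IsPsi.V_H hαm _ hθ.2]

theorem exists_ge_extending (hδ : Order.IsSuccLimit δ) (hcof : δ.cof = ℵ₀)
    (hΦ : IsScottProcess δ Φ) (c : Condition δ Φ n ρ) {α : Ordinal.{u}} (hα : α < δ)
    {m : ℕ} (j : Fin m ↪ Fin c.arity) {χ : Formula L}
    (hχ : χ ∈ E (V (α + 1) δ (H δ j c.path))) :
    ∃ (d : Condition δ Φ n ρ) (h : c ≤ d) (j' : Fin (m + 1) ↪ Fin d.arity),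
      (incl m.le_succ).trans j' = j.trans (incl (arity_mono h)) ∧
        V α δ (H δ j' d.path) = χ := by
  have hα' := hδ.add_one_lt hα
  have hc := c.isPathN.isPsi
  rw [hc.V_H hα'.le, (hc.V_mem hα'.le).E_H] at hχ
  -- An extension of a subtuple comes from an extension `ψ` of the full tuple; the added point `y`
  -- may be an old variable outside the range of `j`.
  obtain ⟨ψ, hψ, y, hy, rfl⟩ := hχ
  obtain ⟨τ, hτ, e, rfl⟩ := hΦ.exists_path_of_mem_E hδ hcof hα c.isPathN hψ
  refine ⟨_, c.le_extendPath _ hτ e hα, extend j y hy, ?_, hτ.isPsi.V_H hα.le _⟩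
  ext i
  exact congrArg Fin.val (extend_castSucc j y hy i)

/-- If no stronger condition distinguished the subtuple `f` from `υ`, then the approximation given
by `c`, together with `f`, would witness `υ ∈ ms(ρ)`. The disagreement is asked for at the level of
the new condition, so that it persists. -/
theorem exists_ge_avoiding (hδ : Order.IsSuccLimit δ) (hcof : δ.cof = ℵ₀)
    (hΦ : IsScottProcess δ Φ) (hρ : IsPathN δ Φ n ρ) (c : Condition δ Φ n ρ) {p : ℕ}
    (f : Fin p ↪ Fin c.arity) {υ : Formula L} (hυ : IsPath δ Φ υ) (hms : υ ∉ ms δ Φ ρ) :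
    ∃ (d : Condition δ Φ n ρ) (h : c ≤ d), V d.level δ (H δ (f.trans (incl (arity_mono h))) d.path)
      ≠ V d.level δ υ := by
  by_contra! hcon
  refine hms ⟨hυ, n, hρ.isPsi, c.arity, c.le_arity, p,
    by simpa using Fintype.card_le_of_embedding f, c.level, c.level_lt, V c.level δ c.path,
    ⟨c.isPathN.mem_inter c.level_lt, ?_⟩, f, ?_⟩
  · have aux : ∀ (m : ℕ) (h : n ≤ m) (σ : Formula L), IsPathN δ Φ m σ → H δ (incl h) σ = ρ →
        V c.level δ σ ∈ F δ ρ := by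
      intro m h σ hσ e
      obtain ⟨k, rfl⟩ := Nat.exists_eq_add_of_le h
      exact hΦ.V_mem_F hδ hσ e c.level_lt
    exact aux _ c.le_arity _ c.isPathN c.H_path
  · rintro α hα hαδ ψ ⟨⟨hψ, hψ'⟩, hF⟩ hV
    obtain ⟨h, τ, hτ, e, rfl⟩ := hΦ.exists_path_of_mem_F hδ hcof hρ hαδ hψ' hF
    -- Any `ψ ∈ F(ρ)` above the approximation of `c` is the projection of a path, hence a condition
    -- stronger than `c` with the same arity and level `α`, to which `hcon` applies.
    let d : Condition δ Φ n ρ := ⟨c.arity, α, τ, h, hαδ, hτ, e⟩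
    have hcd : c ≤ d := by
      refine ⟨hα, le_rfl, ?_⟩
      change V c.level δ (H δ _ τ) = _
      rw [hτ.isPsi.H_refl _ fun i => rfl, ← hV, hτ.isPsi.V_V hα hαδ.le]
    have := hcon d hcd
    change V α δ (H δ f τ) = V α δ υ at this
    rw [← this, hτ.isPsi.V_H hαδ.le]

end Condition

/-- `G N`, for `N ∈ ℕ`, are the restrictions of one infinitary path in which all the formulas of
the Scott process are realized. -/
structure IsGeneric (δ : Ordinal.{u}) (Φ : Ordinal.{u} → Set (Formula L))
    (G : ℕ → Formula L) : Prop where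
  isPathN : ∀ N, IsPathN δ Φ N (G N)
  H_incl : ∀ {M N : ℕ} (h : M ≤ N), H δ (incl h) (G N) = G M
  realize : ∀ α < δ, ∀ m, ∀ φ ∈ Φ α ∩ PsiN L α m,
    ∃ (N : ℕ) (j : Fin m ↪ Fin N), V α δ (H δ j (G N)) = φ
  extend : ∀ α < δ, ∀ (m M : ℕ) (j : Fin m ↪ Fin M), ∀ χ ∈ E (V (α + 1) δ (H δ j (G M))),
    ∃ (N : ℕ) (h : M ≤ N) (j' : Fin (m + 1) ↪ Fin N),
      (incl m.le_succ).trans j' = j.trans (incl h) ∧ V α δ (H δ j' (G N)) = χ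

/-- For each `N`, the approximations of the first `N` variables cohere and reach cofinal levels, so
they converge. The last clause lets facts about the limit be checked on one condition of sufficient
arity and level. -/
theorem exists_limit_condition {δ : Ordinal.{u}} (hδ : Order.IsSuccLimit δ)
    {Φ : Ordinal.{u} → Set (Formula L)} (hΦ : IsScottProcess δ Φ) {n : ℕ} {ρ : Formula L}
    (hρ : IsPathN δ Φ n ρ) {c : ℕ → Condition δ Φ n ρ} (hc : Monotone c)
    (hlarge : ∀ (N : ℕ), ∀ α < δ, ∃ i, N ≤ (c i).arity ∧ α ≤ (c i).level) :
    ∃ G : ℕ → Formula L, (∀ N, IsPathN δ Φ N (G N)) ∧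
      (∀ {M N : ℕ} (h : M ≤ N), H δ (incl h) (G N) = G M) ∧ G n = ρ ∧
      ∀ (i m N : ℕ) (h : N ≤ (c i).arity) (j : Fin m ↪ Fin N), ∀ α ≤ (c i).level,
        V α δ (H δ j (G N)) = V α δ (H δ (j.trans (incl h)) (c i).path) := by
  have hG : ∀ N, ∃ φ, IsPsi δ N φ ∧ ∀ (i : ℕ) (h : N ≤ (c i).arity),
      V (c i).level δ φ = V (c i).level δ (H δ (incl h) (c i).path) := by
    intro N
    obtain ⟨i₀, hi₀, -⟩ := hlarge N 0 hδ.bot_lt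
    have hN : ∀ i, N ≤ (c (i₀ + i)).arity := fun i =>
      hi₀.trans (Condition.arity_mono (hc (Nat.le_add_right _ _)))
    have hH := fun i => (c (i₀ + i)).isPathN.isPsi.H_mem (incl (hN i))
    have key : ∀ (i k : ℕ) (hik : i ≤ k) (h : N ≤ (c i).arity) (h' : N ≤ (c k).arity),
        V (c i).level δ (H δ (incl h') (c k).path) =
          V (c i).level δ (H δ (incl h) (c i).path) := fun i k hik h h' =>
      Condition.V_H_of_le (hc hik) le_rfl (incl h)
    obtain ⟨φ, hφ, hφV⟩ := exists_limit_seq hδ (a := fun i => (c (i₀ + i)).level)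
      (fun i k hik => Condition.level_mono (hc (Nat.add_le_add_left hik _)))
      (fun i => (c _).level_lt)
      (fun β hβ => by
        obtain ⟨i, -, hi⟩ := hlarge 0 β hβ
        exact ⟨i, hi.trans (Condition.level_mono (hc (Nat.le_add_left _ _)))⟩)
      (fun i => (hH i).V_mem (c (i₀ + i)).level_le)
      (fun i k hik => by
        rw [(hH k).V_V (Condition.level_mono (hc (Nat.add_le_add_left hik _))) (c _).level_le]
        exact key _ _ (Nat.add_le_add_left hik _) _ _)
    refine ⟨φ, hφ, fun i h => ?_⟩
    have hi : i ≤ i₀ + i := Nat.le_add_left _ _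
    rw [← hφ.V_V (Condition.level_mono (hc hi)) (c _).level_le, hφV i,
      (hH i).V_V (Condition.level_mono (hc hi)) (c _).level_le]
    exact key _ _ hi h _
  choose G hGm hGV using hG
  have hV : ∀ (i m N : ℕ) (h : N ≤ (c i).arity) (j : Fin m ↪ Fin N), ∀ α ≤ (c i).level,
      V α δ (H δ j (G N)) = V α δ (H δ (j.trans (incl h)) (c i).path) := by
    intro i m N h j α hα
    have hi := (c i).isPathN.isPsi
    have hl := (c i).level_le
    rw [← hi.H_H, (hGm N).V_H (hα.trans hl), (hi.H_mem _).V_H (hα.trans hl),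
      ← (hGm N).V_V hα hl, hGV N i h, (hi.H_mem _).V_V hα hl]
  refine ⟨G, fun N => ⟨hGm N, fun α hα => ?_⟩, fun {M N} h => ?_, ?_, hV⟩
  · obtain ⟨i, hN, hi⟩ := hlarge N α hα
    rw [← (hGm N).V_V hi (c i).level_le, hGV N i hN,
      ((c i).isPathN.isPsi.H_mem _).V_V hi (c i).level_le]
    exact (hΦ.isPathN_H _ (c i).isPathN).mem α hα
  · refine ((hGm N).H_mem _).ext_limit hδ (hGm M) fun α hα => ?_
    obtain ⟨i, hN, hi⟩ := hlarge N α hα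
    rw [hV i M N hN _ α hi, incl_trans_incl, ← (hGm M).V_V hi (c i).level_le,
      hGV M i (h.trans hN), ((c i).isPathN.isPsi.H_mem _).V_V hi (c i).level_le]
  · refine (hGm n).ext_limit hδ hρ.isPsi fun α hα => ?_
    obtain ⟨i, hN, hi⟩ := hlarge n α hα
    rw [← (hGm n).V_V hi (c i).level_le, hGV n i hN,
      ((c i).isPathN.isPsi.H_mem _).V_V hi (c i).level_le, (c i).H_path]

theorem exists_isGeneric {δ : Ordinal.{u}} (hδ : Order.IsSuccLimit δ) (hcof : δ.cof = ℵ₀)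
    {Φ : Ordinal.{u} → Set (Formula L)} (hΦ : IsScottProcess δ Φ)
    (hcount : ∀ α < δ, (Φ α).Countable) {n : ℕ} {ρ : Formula L} (hρ : IsPathN δ Φ n ρ)
    {Υ : Set (Formula L)} (hΥ : Υ.Countable) (hms : Disjoint Υ (ms δ Φ ρ)) :
    ∃ G : ℕ → Formula L, IsGeneric δ Φ G ∧ G n = ρ ∧
      ∀ (m N : ℕ) (j : Fin m ↪ Fin N), H δ j (G N) ∉ Υ := by
  obtain ⟨a, -, haδ, hacof⟩ := exists_monotone_cofinal hcof
  have := fun k => (hcount (a k) (haδ k)).to_subtype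
  have := hΥ.to_subtype
  let P := Condition δ Φ n ρ
  let D₁ : ℕ × ℕ → Set P := fun x => {c | x.1 ≤ c.arity ∧ a x.2 ≤ c.level}
  let D₂ : (Σ k : ℕ, Φ (a k)) → Set P := fun x => {c | a x.1 ≤ c.level ∧
    ∃ (m : ℕ) (j : Fin m ↪ Fin c.arity), V (a x.1) δ (H δ j c.path) = x.2}
  -- Level at least `a k + 1` settles whether `χ` lies in the relevant `E`, for this condition and
  -- for the limit alike; only in that case must `χ` be realized.
  let D₃ : (Σ (k : ℕ) (_ : Φ (a k)) (m M : ℕ), Fin m ↪ Fin M) → Set P :=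
    fun ⟨k, χ, m, M, j⟩ => {c | a k + 1 ≤ c.level ∧ ∃ h : M ≤ c.arity,
      χ.1 ∈ E (V (a k + 1) δ (H δ (j.trans (incl h)) c.path)) →
      ∃ j' : Fin (m + 1) ↪ Fin c.arity,
        (incl m.le_succ).trans j' = j.trans (incl h) ∧ V (a k) δ (H δ j' c.path) = χ}
  -- Elements of `Υ` that are not paths need no care, since all projections of the limit are paths.
  let D₄ : (Σ (_ : Υ) (m M : ℕ), Fin m ↪ Fin M) → Set P :=
    fun ⟨υ, m, M, f⟩ => {c | ∃ h : M ≤ c.arity, IsPath δ Φ υ.1 →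
      V c.level δ (H δ (f.trans (incl h)) c.path) ≠ V c.level δ υ.1}
  have large : ∀ (c : P) (N : ℕ) (α : Ordinal.{u}), α < δ →
      ∃ d, c ≤ d ∧ N ≤ d.arity ∧ α ≤ d.level := fun c N α hα => c.exists_ge hδ hcof hΦ N hα
  have h₁ : ∀ x, IsCofinal (D₁ x) := fun x c => by
    obtain ⟨d, h, h'⟩ := large c x.1 _ (haδ x.2)
    exact ⟨d, h', h⟩
  have h₂ : ∀ x, IsCofinal (D₂ x) := fun ⟨k, φ, hφ⟩ c => by
    obtain ⟨m, hm⟩ := mem_iUnion.1 (hΦ.subset_Psi _ (haδ k) hφ)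
    obtain ⟨d, h, hl, j, hj⟩ := c.exists_ge_realizing hδ hcof hΦ (haδ k) ⟨hφ, hm⟩
    exact ⟨d, ⟨hl, m, j, hj⟩, h⟩
  have h₃ : ∀ x, IsCofinal (D₃ x) := fun ⟨k, χ, m, M, j⟩ c => by
    obtain ⟨d, h, hM, hl⟩ := large c M _ (hδ.add_one_lt (haδ k))
    by_cases hχ : χ.1 ∈ E (V (a k + 1) δ (H δ (j.trans (incl hM)) d.path))
    · obtain ⟨e, h', j', hj', hV⟩ := d.exists_ge_extending hδ hcof hΦ (haδ k) _ hχ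
      exact ⟨e, ⟨hl.trans (Condition.level_mono h'), hM.trans (Condition.arity_mono h'),
        fun _ => ⟨j', hj', hV⟩⟩, h.trans h'⟩
    · exact ⟨d, ⟨hl, hM, fun h => (hχ h).elim⟩, h⟩
  have h₄ : ∀ x, IsCofinal (D₄ x) := fun ⟨υ, m, M, f⟩ c => by
    obtain ⟨d, h, hM, -⟩ := large c M 0 hδ.bot_lt
    by_cases hυ : IsPath δ Φ υ.1
    · obtain ⟨e, h', he⟩ := d.exists_ge_avoiding hδ hcof hΦ hρ (f.trans (incl hM)) hυ
        (disjoint_left.1 hms υ.2)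
      exact ⟨e, ⟨hM.trans (Condition.arity_mono h'), fun _ => he⟩, h.trans h'⟩
    · exact ⟨d, ⟨hM, fun h => (hυ h).elim⟩, h⟩
  obtain ⟨c, hc, hcD⟩ := exists_monotone_meeting
    (⟨n, 0, ρ, le_rfl, hδ.bot_lt, hρ, hρ.isPsi.H_refl _ fun i => rfl⟩ : P)
    (𝒟 := range D₁ ∪ (range D₂ ∪ (range D₃ ∪ range D₄)))
    ((countable_range _).union ((countable_range _).union
      ((countable_range _).union (countable_range _))))
    (by
      rintro _ (⟨x, rfl⟩ | ⟨x, rfl⟩ | ⟨x, rfl⟩ | ⟨x, rfl⟩)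
      exacts [h₁ x, h₂ x, h₃ x, h₄ x])
  obtain ⟨G, hG, hGincl, hGρ, hGV⟩ := exists_limit_condition hδ hΦ hρ hc fun N α hα => by
    obtain ⟨k, hk⟩ := hacof α hα
    obtain ⟨i, hi⟩ := hcD _ (Or.inl ⟨(N, k), rfl⟩)
    exact ⟨i, hi.1, hk.trans hi.2⟩
  refine ⟨G, ⟨hG, hGincl, fun α hα m φ hφ => ?_, fun α hα m M j χ hχ => ?_⟩, hGρ,
    fun m M j hΥ => ?_⟩
  · obtain ⟨k, hk⟩ := hacof α hα
    obtain ⟨φ', hφ', rfl⟩ := hΦ.exists_V_eq hk (haδ k) hφ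
    obtain ⟨i, hi, m', j, hj⟩ := hcD _ (Or.inr (Or.inl ⟨⟨k, φ', hφ'.1⟩, rfl⟩))
    have hp := (c i).isPathN.isPsi.H_mem j
    dsimp only at hj
    -- `D₂` leaves the arity open; it is recovered from the disjointness of the sets `Ψ^n_α`.
    obtain ⟨-, rfl⟩ := IsPsi.unique (hj ▸ hp.V_mem (haδ k).le) hφ'.2
    refine ⟨(c i).arity, j, ?_⟩
    have := hGV i _ _ le_rfl j (a k) hi
    rw [← ((hG _).isPsi.H_mem j).V_V hk (haδ k).le, this]
    exact congrArg _ hj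
  · obtain ⟨k, hk⟩ := hacof α hα
    have hp := hΦ.isPathN_H j (hG M)
    have hk' := hδ.add_one_lt (haδ k)
    obtain ⟨χ', hχ', rfl⟩ := hΦ.exists_mem_E_lift hδ hk (haδ k) hp hχ
    have hmem : χ' ∈ Φ (a k) := hΦ.E_subset _ hk' _ (hp.mem _ hk') hχ'
    obtain ⟨i, hl, hM, hi⟩ := hcD _ (Or.inr (Or.inr (Or.inl ⟨⟨k, ⟨χ', hmem⟩, m, M, j⟩, rfl⟩)))
    rw [hGV i m M hM j _ hl] at hχ'
    obtain ⟨j', hj', hV⟩ := hi hχ'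
    refine ⟨(c i).arity, hM, j', hj', ?_⟩
    have := hGV i _ _ le_rfl j' (a k) ((lt_add_one _).le.trans hl)
    rw [← ((hG _).isPsi.H_mem j').V_V hk (haδ k).le, this]
    exact congrArg _ hV
  · obtain ⟨i, hM, hi⟩ := hcD _ (Or.inr (Or.inr (Or.inr ⟨⟨⟨_, hΥ⟩, m, M, j⟩, rfl⟩)))
    exact hi (hΦ.isPathN_H j (hG M)).isPath (hGV i m M hM j _ le_rfl).symm

/-! ### The process generated by a generic sequence -/

/-- Two subtuples of a tuple fit into one of length exactly `m + k`, as (8) demands. Entries of `j'`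
already listed by `j` leave empty slots, which are filled by the fresh variables `N + t`; this is
why the target is `Fin (N + k)`. -/
theorem exists_joint_embedding {m k N : ℕ} (j : Fin m ↪ Fin N) (j' : Fin k ↪ Fin N) :
    ∃ (e : Fin (m + k) ↪ Fin (N + k)) (f : Fin k ↪ Fin (m + k)),
      (incl (m.le_add_right k)).trans e = j.trans (incl (N.le_add_right k)) ∧
        f.trans e = j'.trans (incl (N.le_add_right k)) := by
  classical
  let e : Fin (m + k) → Fin (N + k) := Fin.addCases (motive := fun _ => Fin (N + k))
    (fun i => Fin.castAdd k (j i))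
    (fun t => if ∃ i, j i = j' t then Fin.natAdd N t else Fin.castAdd k (j' t))
  have he₁ : ∀ i, e (Fin.castAdd k i) = Fin.castAdd k (j i) := fun i => Fin.addCases_left i
  have he₂ : ∀ t, e (Fin.natAdd m t) =
      if ∃ i, j i = j' t then Fin.natAdd N t else Fin.castAdd k (j' t) := fun t =>
    Fin.addCases_right t
  have hne : ∀ (x : Fin N) (y : Fin k), Fin.castAdd k x ≠ Fin.natAdd N y := fun x y h => by
    have := congrArg Fin.val h
    simp only [Fin.val_castAdd, Fin.val_natAdd] at this
    omega
  have hinj : Function.Injective e := by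
    intro a b hab
    induction a using Fin.addCases with
    | left i =>
      induction b using Fin.addCases with
      | left i' =>
        rw [he₁, he₁] at hab
        rw [j.injective (Fin.castAdd_injective _ _ hab)]
      | right t =>
        rw [he₁, he₂] at hab
        split_ifs at hab with h
        · exact (hne _ _ hab).elim
        · exact (h ⟨i, Fin.castAdd_injective _ _ hab⟩).elim
    | right s =>
      induction b using Fin.addCases with
      | left i =>
        rw [he₁, he₂] at hab
        split_ifs at hab with h
        · exact (hne _ _ hab.symm).elim
        · exact (h ⟨i, (Fin.castAdd_injective _ _ hab).symm⟩).elim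
      | right t =>
        rw [he₂, he₂] at hab
        split_ifs at hab
        · rw [Fin.natAdd_injective _ _ hab]
        · exact (hne _ _ hab.symm).elim
        · exact (hne _ _ hab).elim
        · rw [j'.injective (Fin.castAdd_injective _ _ hab)]
  have hf : ∀ t, ∃ x, e x = Fin.castAdd k (j' t) := fun t => by
    by_cases h : ∃ i, j i = j' t
    · obtain ⟨i, hi⟩ := h
      exact ⟨Fin.castAdd k i, by rw [he₁, hi]⟩
    · exact ⟨Fin.natAdd m t, by rw [he₂, if_neg h]⟩
  choose f hf using hf
  have hfinj : Function.Injective f := fun s t h => by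
    have h' := hf s
    rw [h, hf t] at h'
    exact (j'.injective (Fin.castAdd_injective _ _ h')).symm
  refine ⟨⟨e, hinj⟩, ⟨f, hfinj⟩, ?_, ?_⟩
  · exact Function.Embedding.ext he₁
  · exact Function.Embedding.ext hf

/-- The set of all horizontal projections of the formulas `G N`. -/
def generated (δ : Ordinal.{u}) (G : ℕ → Formula L) : Set (Formula L) :=
  {φ | ∃ (m N : ℕ) (j : Fin m ↪ Fin N), φ = H δ j (G N)}

theorem countable_generated (δ : Ordinal.{u}) (G : ℕ → Formula L) :
    (generated δ G).Countable := by
  refine (countable_range fun x : Σ m N : ℕ, Fin m ↪ Fin N => H δ x.2.2 (G x.2.1)).mono ?_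
  rintro _ ⟨m, N, j, rfl⟩
  exact ⟨⟨m, N, j⟩, rfl⟩

namespace IsGeneric

variable {δ : Ordinal.{u}} {Φ : Ordinal.{u} → Set (Formula L)} {G : ℕ → Formula L}

theorem isPsi_H (hG : IsGeneric δ Φ G) {m N : ℕ} (j : Fin m ↪ Fin N) :
    IsPsi δ m (H δ j (G N)) :=
  (hG.isPathN N).isPsi.H_mem j

theorem H_trans_incl (hG : IsGeneric δ Φ G) {m M N : ℕ} (j : Fin m ↪ Fin M) (h : M ≤ N) :
    H δ (j.trans (incl h)) (G N) = H δ j (G M) := by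
  rw [← (hG.isPathN N).isPsi.H_H, hG.H_incl]

theorem H_mem_generated (hG : IsGeneric δ Φ G) {m N : ℕ} (j : Fin m ↪ Fin N) :
    H δ j (G N) ∈ generated δ G ∩ PsiN L δ m :=
  ⟨⟨m, N, j, rfl⟩, hG.isPsi_H j⟩

theorem mem_generated_inter (hG : IsGeneric δ Φ G) {m : ℕ} {φ : Formula L}
    (h : φ ∈ generated δ G ∩ PsiN L δ m) (k : ℕ) :
    ∃ N ≥ k, ∃ j : Fin m ↪ Fin N, φ = H δ j (G N) := by
  obtain ⟨⟨m', N, j, rfl⟩, hm⟩ := h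
  obtain ⟨-, rfl⟩ := IsPsi.unique (hG.isPsi_H j) hm
  exact ⟨max k N, le_max_left _ _, j.trans (incl (le_max_right _ _)), (hG.H_trans_incl j _).symm⟩

theorem generated_subset (hG : IsGeneric δ Φ G) : generated δ G ⊆ Psi L δ := by
  rintro _ ⟨m, N, j, rfl⟩
  exact mem_iUnion.2 ⟨m, hG.isPsi_H j⟩

theorem mem_generated (hG : IsGeneric δ Φ G) (N : ℕ) : G N ∈ generated δ G :=
  ⟨N, N, incl le_rfl, (hG.H_incl le_rfl).symm⟩

/-- A generic sequence extends a Scott process of limit length by one level. -/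
theorem isScottProcess (hδ : Order.IsSuccLimit δ) (hΦ : IsScottProcess δ Φ)
    (hG : IsGeneric δ Φ G) :
    IsScottProcess (δ + 1) (Function.update Φ δ (generated δ G)) := by
  have hlt : ∀ α < δ, Function.update Φ δ (generated δ G) α = Φ α := fun α hα =>
    Function.update_of_ne hα.ne _ _
  -- As `δ` is a limit, it is not of the form `α + 1`, so conditions (2) and (6) concern only old
  -- levels.
  have hsucc : ∀ α, α + 1 < δ + 1 → α + 1 < δ := fun α hα =>
    hδ.add_one_lt (Order.add_one_le_iff.1 (Order.lt_add_one_iff.1 hα))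
  have hpath : ∀ {m N : ℕ} (j : Fin m ↪ Fin N), IsPathN δ Φ m (H δ j (G N)) := fun j =>
    hΦ.isPathN_H j (hG.isPathN _)
  refine ⟨fun α hα => ?_, fun α hα => ?_, fun α β hαβ hβ => ?_, fun α hα n j => ?_,
    fun α hα m n h => ?_, fun α hα => ?_, fun α β hαβ hβ n φ hφ => ?_, fun α hα n m => ?_⟩
  · obtain rfl | hα := (Order.lt_add_one_iff.1 hα).eq_or_lt
    · rw [Function.update_self]
      exact hG.generated_subset
    · rw [hlt α hα]
      exact hΦ.subset_Psi α hα
  · have hα := hsucc α hα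
    rw [hlt _ hα, hlt _ ((lt_add_one α).trans hα)]
    exact hΦ.E_subset α hα
  · obtain rfl | hβ := (Order.lt_add_one_iff.1 hβ).eq_or_lt
    · rw [hlt α hαβ, Function.update_self]
      refine Subset.antisymm (fun φ hφ => ?_) ?_
      · obtain ⟨m, hm⟩ := mem_iUnion.1 (hΦ.subset_Psi α hαβ hφ)
        obtain ⟨N, j, rfl⟩ := hG.realize α hαβ m φ ⟨hφ, hm⟩
        exact mem_image_of_mem _ (hG.H_mem_generated j).1
      · rintro _ ⟨_, ⟨m, N, j, rfl⟩, rfl⟩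
        exact (hpath j).mem α hαβ
    · rw [hlt β hβ, hlt α (hαβ.trans hβ)]
      exact hΦ.image_V α β hαβ hβ
  · obtain rfl | hα := (Order.lt_add_one_iff.1 hα).eq_or_lt
    · rw [Function.update_self]
      intro φ hφ
      obtain ⟨N, -, i, rfl⟩ := hG.mem_generated_inter hφ 0
      rw [(hG.isPathN N).isPsi.H_H]
      exact hG.H_mem_generated _
    · rw [hlt α hα]
      exact hΦ.perm_mem α hα n j
  · obtain rfl | hα := (Order.lt_add_one_iff.1 hα).eq_or_lt
    · rw [Function.update_self]
      refine Subset.antisymm (fun φ hφ => ?_) ?_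
      · obtain ⟨k, rfl⟩ := Nat.exists_eq_add_of_le h.le
        obtain ⟨N, hN, j, rfl⟩ := hG.mem_generated_inter hφ k
        obtain ⟨e, -, he, -⟩ := exists_joint_embedding j (incl hN)
        refine ⟨_, hG.H_mem_generated e, ?_⟩
        rw [(hG.isPathN _).isPsi.H_H, he, hG.H_trans_incl]
      · rintro _ ⟨φ, hφ, rfl⟩
        obtain ⟨N, -, j, rfl⟩ := hG.mem_generated_inter hφ 0
        rw [(hG.isPathN N).isPsi.H_H]
        exact hG.H_mem_generated _
    · rw [hlt α hα]
      exact hΦ.image_H α hα m n h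
  · have hα := hsucc α hα
    rw [hlt _ hα]
    exact hΦ.E_eq α hα
  · obtain rfl | hβ := (Order.lt_add_one_iff.1 hβ).eq_or_lt
    · rw [Function.update_self] at hφ ⊢
      intro χ hχ
      obtain ⟨M, -, j, rfl⟩ := hG.mem_generated_inter hφ 0
      obtain ⟨N, h, j', hj', rfl⟩ := hG.extend α hαβ n M j χ hχ
      refine mem_image_of_mem _ ⟨hG.H_mem_generated j', ?_⟩
      rw [(hG.isPathN N).isPsi.H_H, hj', hG.H_trans_incl]
    · rw [hlt β hβ] at hφ ⊢
      exact hΦ.E_V_subset α β hαβ hβ n φ hφ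
  · obtain rfl | hα := (Order.lt_add_one_iff.1 hα).eq_or_lt
    · rw [Function.update_self]
      intro φ hφ ψ hψ
      obtain ⟨M, -, j, rfl⟩ := hG.mem_generated_inter hφ 0
      obtain ⟨N, hN, j', rfl⟩ := hG.mem_generated_inter hψ M
      obtain ⟨e, f, he, hf⟩ := exists_joint_embedding (j.trans (incl hN)) j'
      have hp := (hG.isPathN (N + m)).isPsi
      refine ⟨_, hG.H_mem_generated e, f, ?_, ?_⟩
      · rw [hp.H_H, he, hG.H_trans_incl, hG.H_trans_incl]
      · rw [hp.H_H, hf, hG.H_trans_incl]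
    · rw [hlt α hα]
      exact hΦ.amalgamate α hα n m

end IsGeneric

end ScottProc

/-! ### The extension theorem -/

theorem mainTheorem7 (L : FirstOrder.Language.{v, u}) [L.IsRelational] [Nonempty (L.Relations 0)]
    (δ : Ordinal.{u}) (hδ : Order.IsSuccLimit δ) (hcof : δ.cof = ℵ₀)
    (Φ : Ordinal.{u} → Set (ScottProc.Formula L)) (hΦ : ScottProc.IsScottProcess δ Φ)
    (hcount : ∀ α < δ, (Φ α).Countable)
    (ρ : ScottProc.Formula L) (hρ : ScottProc.IsPath δ Φ ρ) :
    (∃ Φδ : Set (ScottProc.Formula L), Φδ.Countable ∧ Φδ ⊆ ScottProc.Psi L δ ∧ ρ ∈ Φδ ∧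
      ScottProc.IsScottProcess (δ + 1) (Function.update Φ δ Φδ)) ∧
    ∀ Υ : Set (ScottProc.Formula L), Υ.Countable → Υ ⊆ ScottProc.Psi L δ → Disjoint Υ (ScottProc.ms δ Φ ρ) →
      ∃ Φδ : Set (ScottProc.Formula L), Φδ.Countable ∧ Φδ ⊆ ScottProc.Psi L δ ∧ ρ ∈ Φδ ∧
        ScottProc.IsScottProcess (δ + 1) (Function.update Φ δ Φδ) ∧ Disjoint Φδ Υ := by
  obtain ⟨n, hρ'⟩ := hρ.exists_isPathN
  have key : ∀ Υ : Set (ScottProc.Formula L), Υ.Countable → Disjoint Υ (ScottProc.ms δ Φ ρ) →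
      ∃ Φδ : Set (ScottProc.Formula L), Φδ.Countable ∧ Φδ ⊆ ScottProc.Psi L δ ∧ ρ ∈ Φδ ∧
        ScottProc.IsScottProcess (δ + 1) (Function.update Φ δ Φδ) ∧ Disjoint Φδ Υ := by
    intro Υ hΥ hms
    obtain ⟨G, hG, rfl, hav⟩ := ScottProc.exists_isGeneric hδ hcof hΦ hcount hρ' hΥ hms
    refine ⟨ScottProc.generated δ G, ScottProc.countable_generated δ G, hG.generated_subset,
      hG.mem_generated n, hG.isScottProcess hδ hΦ, Set.disjoint_left.2 ?_⟩
    rintro _ ⟨m, N, j, rfl⟩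
    exact hav m N j
  refine ⟨?_, fun Υ hΥ _ hms => key Υ hΥ hms⟩
  obtain ⟨Φδ, h1, h2, h3, h4, -⟩ := key ∅ Set.countable_empty (Set.empty_disjoint _)
  exact ⟨Φδ, h1, h2, h3, h4⟩
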